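/- **Setting.** Let $\Sigma$ be a finite nonempty alphabet. A timed word is a finite sequence $(t_1\cdot a_1)\cdots(t_k\cdot a_k)$ with $t_i\in\mathbb{R}_{\ge 0}$, $a_i\in\Sigma$; it is half-integral if every $t_i\in\frac12\mathbb{N}$; $\mathcal{HI}$ is the set of half-integral words. A 1-DTA is a deterministic one-clock timed automaton (guards: conjunctions of $c<x$, $x=c$, $x<c$ with $c\in\mathbb{N}$; each transition resets the clock or keeps it). Let $L$ be a language accepted by some 1-DTA, and let $K_L$ be the least maximum constant of a 1-DTA accepting $L$. A reset function is a map $R$ from timed words to $\mathbb{R}_{\ge0}$ with $R(\epsilon)=0$ and $R(u(t\cdot a))\in\{0,R(u)+t\}$. The syntactic reset function $\mathbf{R}^L$ is the one with $\mathbf{R}^L(u(t\cdot a))=0$ if $(u(t\cdot a))^{-1}L$ is accepted by a 1-DTA, and $\mathbf{R}^L(u(t\cdot a))=\mathbf{R}^L(u)+t$ otherwise. For $u,v\in\mathcal{HI}$ put $u\approx^L v$ iff $\mathbf{R}^L(u)=\mathbf{R}^L(v)$ and $u^{-1}L=v^{-1}L$; let $n$ be the number of classes of $\approx^L$. For $x\ge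 0$ let $\mathit{hi}(x)=x$ if $x\in\mathbb{N}$ and $\lfloor x\rfloor+\frac12$ otherwise. The normal form of a timed word under $R$ is given by $N^R(\epsilon)=\epsilon$ and $N^R(u(t\cdot a))=N^R(u)(t'\cdot a)$, $t'=\mathit{hi}(R(u)+t)-\mathit{hi}(R(u))$; the possible normal forms of $w$ are the words $N^R(w)$, $R$ a reset function. The $K$-regions are $\{c\}$ ($0\le c\le K$), $(c,c+1)$ ($0\le c<K$) and $(K,\infty)$. A strict $K$-acceptor is a complete 1-DTA with maximum constant $K$ whose guards are $K$-regions, in which every state $q$ carries a $K$-region containing the clock value of every run arriving in $q$ (if some transition into $q$ resets, all do and the region is $\{0\}$; otherwise all transitions into $q$ have the region of $q$ as guard), and in which every transition with guard $x=c$ resets the clock. **Observation tables.** An observation table is $\mathcal{T}=(K,S,E,T)$ with $K\in\mathbb{N}$, finite $S,E\subseteq\mathcal{HI}$ containing $\epsilon$, $S$ prefix-closed, $E$ suffix-closed, and $T=(T_1,r)$ on $(S\cup S\Sigma_K)\times E$, where $\Sigma_K=\{0,\frac12,\dots,K,K+\frac12\}\times\Sigma$; $T_1(s,e)\in\{0,1\}$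 says whether $se\in L$ (filled by membership queries), and $r$ is a possible reset assignment: $r(s,e)=R(se)$ for all cells, for some reset function $R$ taking no strictly positive integer value. Write $\mathit{row}(s)=T(s,\cdot)$ and $r(s)=r(s,\epsilon)$. $\mathcal{T}$ is closed if every $\mathit{row}(w)$, $w\in S\Sigma_K$, equals some $\mathit{row}(s)$, $s\in S$; consistent if (a) $\mathit{row}(s_1)=\mathit{row}(s_2)$ implies $\mathit{row}(s_1p)=\mathit{row}(s_2p)$ for $s_1,s_2\in S$, $p\in\Sigma_K$, and (b) $r(s)+t>K$ implies $\mathit{row}(s(t\cdot a))=\mathit{row}(s(K+\frac12\cdot a))$ whenever $s(t\cdot a)\in S\cup S\Sigma_K$; valid if $r\le K$ everywhere. The conjecture $\mathcal{A}_{\mathcal T}$ has states $\mathit{row}(s)$, $s\in S$, initial state $\mathit{row}(\epsilon)$, final states those with $T_1(s,\epsilon)=1$, and, whenever $s,s'\in S$, $(t\cdot a)\in\Sigma_K$ and $\mathit{row}(s(t\cdot a))=\mathit{row}(s')$, an $a$-transition from $\mathit{row}(s)$ to $\mathit{row}(s')$ whose guard is the $K$-region of $r(s)+t$ and which resets iff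 $r(s')=0$. **The Normal Teacher algorithm.** The pool $P_0$ consists of all tables with $K=0$, $S=E=\{\epsilon\}$, one for each possible reset assignment (their common cells are filled once, with one membership query each). The tables of $P_i$ are removed and processed one after the other, in any order; once $P_i$ is empty the algorithm goes on with $P_{i+1}$. Processing $\mathcal{T}$ means: - If $\mathcal{T}$ is not closed, consistent and valid, apply one applicable action: (1) add to $S$ some $w\in S\Sigma_K$ whose row is not the row of any $s\in S$; (2) add to $E$ a word $pe$ where $\mathit{row}(s_1)=\mathit{row}(s_2)$ but $T(s_1p,e)\ne T(s_2p,e)$ for some $s_1,s_2\in S$, $p\in\Sigma_K$, $e\in E$; (3) if (b) fails, or (4) if some $r(s,e)>K$, increase $K$ by one. - Otherwise ask whether $\mathcal{A}_{\mathcal T}$ accepts exactly $L$. If so, return $\mathcal{A}_{\mathcal T}$ and halt. If not, the Teacher returns an arbitrary counterexample $w$, and all prefixes of all possible normal forms of $w$ are added to $S$. After an action or a counterexample, one membership query is asked for each new cell, and one copy of the extended table for each possible reset assignment extending that of $\mathcal{T}$ is put into $P_{i+1}$. **Theorem.** Whatever the choices of the Learner and the counterexamples of the Teacher, the Normal Teacher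 algorithm terminates and returns, for some $K\ge K_L$, a strict $K$-acceptor accepting $L$ whose reset function (the clock value after each timed word) takes values in $[0,K]\setminus\mathbb{N}_{>0}$. Moreover, with $H=K_L+n$ and $m$ the maximum of $1$ and the length of the longest counterexample received, it processes $$O\bigl(2^{H^3 m 2^m|\Sigma|}\,H\bigr)$$ observation tables and asks $$O\bigl(2^{H^3 m 2^m|\Sigma|}\,H^3 m 2^m|\Sigma|\bigr)$$ membership queries, where the constants in $O(\cdot)$ are absolute. -/

import Mathlib

open scoped NNReal

universe u

/-! ### Timed words and residuals -/

/-- A timed word `(t₁·a₁)⋯(tₖ·aₖ)`: a finite sequence of pairs (delay, letter). -/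
abbrev TimedWord (α : Type u) : Type u := List (ℝ≥0 × α)

/-- The residual language `u⁻¹L`. -/
def residualLang {α : Type u} (L : Set (TimedWord α)) (u : TimedWord α) : Set (TimedWord α) :=
  {w | u ++ w ∈ L}

/-! ### Clock constraints and one-clock timed automata -/

/-- Clock constraints `c < x`, `x = c`, `x < c` and conjunctions, with `c` a natural number. -/
inductive ClockConstraint : Type
  | gt (c : ℕ) : ClockConstraint
  | eq (c : ℕ) : ClockConstraint
  | lt (c : ℕ) : ClockConstraint
  | and (φ ψ : ClockConstraint) : ClockConstraint

/-- The set of clock values satisfying a constraint. -/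
def ClockConstraint.denote : ClockConstraint → Set ℝ≥0
  | .gt c => {x | (c : ℝ≥0) < x}
  | .eq c => {x | x = (c : ℝ≥0)}
  | .lt c => {x | x < (c : ℝ≥0)}
  | .and φ ψ => φ.denote ∩ ψ.denote

/-- The largest constant that occurs in a constraint. -/
def ClockConstraint.maxConst : ClockConstraint → ℕ
  | .gt c => c
  | .eq c => c
  | .lt c => c
  | .and φ ψ => max φ.maxConst ψ.maxConst

/-- A transition `(q, q', a, φ, r)`; `keep = false` means that the clock is reset (`r = 0`),
`keep = true` that it is not (`r = 1`). -/
structure ClockTransition (α : Type u) (Q : Type u) : Type u where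
  src : Q
  tgt : Q
  letter : α
  guard : ClockConstraint
  keep : Bool

/-- A one-clock timed automaton over `α`. -/
structure OneTA (α : Type u) : Type (u + 1) where
  Q : Type u
  finite_Q : Finite Q
  init : Q
  trans : Set (ClockTransition α Q)
  finite_trans : trans.Finite
  final : Set Q

namespace OneTA

variable {α : Type u}

/-- `A.Run q ν w θs q' ν'`: the sequence of transitions `θs` is a run of `A` on `w`
from the configuration `(q, ν)` to the configuration `(q', ν')`. -/
inductive Run (A : OneTA α) :
    A.Q → ℝ≥0 → TimedWord α → List (ClockTransition α A.Q) → A.Q → ℝ≥0 → Prop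
  | nil (q : A.Q) (ν : ℝ≥0) : Run A q ν [] [] q ν
  | cons (θ : ClockTransition α A.Q) (ν t : ℝ≥0) (w : TimedWord α)
      (θs : List (ClockTransition α A.Q)) (q' : A.Q) (ν' : ℝ≥0)
      (hθ : θ ∈ A.trans) (hguard : ν + t ∈ θ.guard.denote)
      (hrun : Run A θ.tgt (if θ.keep then ν + t else 0) w θs q' ν') :
      Run A θ.src ν ((t, θ.letter) :: w) (θ :: θs) q' ν'

/-- The language of `A`: the timed words with an accepting run from the initial configuration. -/
def lang (A : OneTA α) : Set (TimedWord α) :=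
  {w | ∃ θs q ν, A.Run A.init 0 w θs q ν ∧ q ∈ A.final}

def IsDeterministic (A : OneTA α) : Prop :=
  ∀ θ ∈ A.trans, ∀ θ₁ ∈ A.trans, θ ≠ θ₁ →
    θ.src ≠ θ₁.src ∨ θ.letter ≠ θ₁.letter ∨ Disjoint θ.guard.denote θ₁.guard.denote

/-- Every timed word has exactly one run from the initial configuration. -/
def IsComplete (A : OneTA α) : Prop :=
  ∀ w : TimedWord α, ∃! θs : List (ClockTransition α A.Q), ∃ q ν, A.Run A.init 0 w θs q ν

/-- The largest constant that occurs in the transitions of `A` (`0` if there are none). -/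
noncomputable def maxConst (A : OneTA α) : ℕ :=
  sSup ((fun θ => θ.guard.maxConst) '' A.trans)

end OneTA

/-- `L` is the language of some 1-DTA. -/
def IsDTARecognizable {α : Type u} (L : Set (TimedWord α)) : Prop :=
  ∃ A : OneTA α, A.IsDeterministic ∧ A.lang = L

/-- `K_L`: the smallest maximum constant of a 1-DTA that accepts `L`. -/
noncomputable def minConst {α : Type u} (L : Set (TimedWord α)) : ℕ :=
  sInf {K | ∃ A : OneTA α, A.IsDeterministic ∧ A.maxConst = K ∧ A.lang = L}

/-! ### Regions, acceptors, strictness -/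

/-- Region equivalence `y ≡ z`: same integral part, and the fractional parts vanish together. -/
def RegionEquiv (y z : ℝ≥0) : Prop :=
  ⌊y⌋₊ = ⌊z⌋₊ ∧ ((⌊y⌋₊ : ℝ≥0) = y ↔ (⌊z⌋₊ : ℝ≥0) = z)

/-- Region equivalence with respect to the constant `K`. -/
def KRegionEquiv (K : ℕ) (y z : ℝ≥0) : Prop :=
  RegionEquiv y z ∨ ((K : ℝ≥0) < y ∧ (K : ℝ≥0) < z)

/-- `X` is a `K`-region, i.e. a class of `KRegionEquiv K`. -/
def IsKRegion (K : ℕ) (X : Set ℝ≥0) : Prop :=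
  ∃ y : ℝ≥0, X = {z | KRegionEquiv K y z}

/-- A `K`-acceptor: a complete 1-DTA of maximum constant `K` whose guards are `K`-regions and whose
states carry a `K`-region such that every word reaching a state arrives with a clock value in its
region; syntactically, if some transition into `q` resets the clock then all of them do and the
region of `q` is `{0}`, and otherwise all of them have the region of `q` as guard. -/
structure OneTA.IsAcceptor {α : Type u} (K : ℕ) (A : OneTA α) : Prop where
  det : A.IsDeterministic
  complete : A.IsComplete
  maxConst_eq : A.maxConst = K
  guard_region : ∀ θ ∈ A.trans, IsKRegion K θ.guard.denote
  region : ∃ reg : A.Q → Set ℝ≥0,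
    (∀ q, IsKRegion K (reg q)) ∧
    (∀ w θs q ν, A.Run A.init 0 w θs q ν → ν ∈ reg q) ∧
    (∀ q, (∃ θ ∈ A.trans, θ.tgt = q ∧ θ.keep = false) →
      reg q = {0} ∧ ∀ θ ∈ A.trans, θ.tgt = q → θ.keep = false) ∧
    (∀ q, (∀ θ ∈ A.trans, θ.tgt = q → θ.keep = true) →
      ∀ θ ∈ A.trans, θ.tgt = q → θ.guard.denote = reg q)

/-- A strict `K`-acceptor: every transition with an equality guard `x = c` resets the clock. -/
structure OneTA.IsStrictAcceptor {α : Type u} (K : ℕ) (A : OneTA α) : Prop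
    extends OneTA.IsAcceptor K A where
  strict : ∀ θ ∈ A.trans, ∀ c : ℕ, θ.guard.denote = {(c : ℝ≥0)} → θ.keep = false

/-! ### Reset functions, half-integral words, normal forms -/

/-- `x` is a strictly positive integer. -/
def IsPosInt (x : ℝ≥0) : Prop := ∃ k : ℕ, 0 < k ∧ x = (k : ℝ≥0)

structure IsResetFunction {α : Type u} (R : TimedWord α → ℝ≥0) : Prop where
  nil : R [] = 0
  snoc : ∀ (u : TimedWord α) (t : ℝ≥0) (a : α), R (u ++ [(t, a)]) = 0 ∨ R (u ++ [(t, a)]) = R u + t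

/-- A reset function that takes no strictly positive integral value. -/
structure IsStrictResetFunction {α : Type u} (R : TimedWord α → ℝ≥0) : Prop
    extends IsResetFunction R where
  not_posInt : ∀ u, ¬ IsPosInt (R u)

open Classical in
/-- Auxiliary to `resetBy`: `pre` is the part already read, with clock value `v`. -/
noncomputable def resetByAux {α : Type u} (P : TimedWord α → Prop) :
    TimedWord α → ℝ≥0 → TimedWord α → ℝ≥0
  | _, v, [] => v
  | pre, v, (t, a) :: w =>
      resetByAux P (pre ++ [(t, a)]) (if P (pre ++ [(t, a)]) then 0 else v + t) w

/-- The clock value after a word when the clock is reset exactly after the nonempty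
prefixes that satisfy `P`. -/
noncomputable def resetBy {α : Type u} (P : TimedWord α → Prop) (w : TimedWord α) : ℝ≥0 :=
  resetByAux P [] 0 w

/-- The syntactic reset function `R^L`; see `synReset_nil` and `synReset_snoc`. -/
noncomputable def synReset {α : Type u} (L : Set (TimedWord α)) : TimedWord α → ℝ≥0 :=
  resetBy (fun w => IsDTARecognizable (residualLang L w))

open Classical in
theorem resetByAux_snoc {α : Type u} (P : TimedWord α → Prop) (w : TimedWord α) (t : ℝ≥0) (a : α) :
    ∀ (pre : TimedWord α) (v : ℝ≥0), resetByAux P pre v (w ++ [(t, a)]) =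
      if P (pre ++ w ++ [(t, a)]) then 0 else resetByAux P pre v w + t := by
  induction w with
  | nil => intro pre v; simp [resetByAux]
  | cons p w ih =>
      intro pre v
      obtain ⟨s, b⟩ := p
      simp [resetByAux, ih]

theorem synReset_nil {α : Type u} (L : Set (TimedWord α)) : synReset L [] = 0 := rfl

open Classical in
theorem synReset_snoc {α : Type u} (L : Set (TimedWord α)) (w : TimedWord α) (t : ℝ≥0) (a : α) :
    synReset L (w ++ [(t, a)]) =
      if IsDTARecognizable (residualLang L (w ++ [(t, a)])) then 0 else synReset L w + t := by
  simp only [synReset, resetBy, resetByAux_snoc, List.nil_append]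

/-- `x = k/2` for some natural number `k`. -/
def IsHalfInt (x : ℝ≥0) : Prop := ∃ k : ℕ, x = (k : ℝ≥0) / 2

/-- Half-integral timed words. -/
def IsHIWord {α : Type u} (w : TimedWord α) : Prop := ∀ p ∈ w, IsHalfInt p.1

open Classical in
/-- The half-integral value region equivalent to `x`. -/
noncomputable def hi (x : ℝ≥0) : ℝ≥0 :=
  if (⌊x⌋₊ : ℝ≥0) = x then x else (⌊x⌋₊ : ℝ≥0) + 1 / 2

/-- Auxiliary to `normalForm`: `pre` is the part already read. The new delay `t'` is the one with
`hi (R pre) + t' = hi (R pre + t)`; as `hi` is monotone, the subtraction does not truncate. -/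
noncomputable def normalFormAux {α : Type u} (R : TimedWord α → ℝ≥0) :
    TimedWord α → TimedWord α → TimedWord α
  | _, [] => []
  | pre, (t, a) :: w => (hi (R pre + t) - hi (R pre), a) :: normalFormAux R (pre ++ [(t, a)]) w

/-- The normal form `N^R(w)`. -/
noncomputable def normalForm {α : Type u} (R : TimedWord α → ℝ≥0) (w : TimedWord α) :
    TimedWord α :=
  normalFormAux R [] w

/-- All possible normal forms of `w`. -/
def normalForms {α : Type u} (w : TimedWord α) : Set (TimedWord α) :=
  {v | ∃ R : TimedWord α → ℝ≥0, IsResetFunction R ∧ v = normalForm R w}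

/-- The equivalence `≈^L` on half-integral words. -/
def synSetoid {α : Type u} (L : Set (TimedWord α)) : Setoid {w : TimedWord α // IsHIWord w} where
  r v w := synReset L v = synReset L w ∧ residualLang L v = residualLang L w
  iseqv := ⟨fun _ => ⟨rfl, rfl⟩, fun h => ⟨h.1.symm, h.2.symm⟩,
    fun h h' => ⟨h.1.trans h'.1, h.2.trans h'.2⟩⟩

/-- The number of classes of `≈^L`. -/
noncomputable def synIndex {α : Type u} (L : Set (TimedWord α)) : ℕ :=
  Nat.card (Quotient (synSetoid L))

/-! ### Observation tables -/

/-- `Σ_K = {0, 1/2, …, K, K + 1/2} × Σ`. -/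
def sigmaK (α : Type u) (K : ℕ) : Set (ℝ≥0 × α) :=
  {p | IsHalfInt p.1 ∧ p.1 < (K : ℝ≥0) + 1}

/-- The one letter extensions `S Σ_K`. -/
def extensions {α : Type u} (K : ℕ) (S : Set (TimedWord α)) : Set (TimedWord α) :=
  {w | ∃ s ∈ S, ∃ p ∈ sigmaK α K, w = s ++ [p]}

/-- The cells `(S ∪ S Σ_K) × E` of a table. -/
def cells {α : Type u} (K : ℕ) (S E : Set (TimedWord α)) : Set (TimedWord α × TimedWord α) :=
  (S ∪ extensions K S) ×ˢ E

/-- An observation table. `entry s e` is the content of the cell `(s, e)`; it is meaningful on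
`cells K S E` only, and is fixed to a default value elsewhere, so that two tables are equal as soon
as they have the same `K`, `S`, `E` and the same contents. -/
structure ObsTable (α : Type u) : Type u where
  K : ℕ
  S : Set (TimedWord α)
  E : Set (TimedWord α)
  entry : TimedWord α → TimedWord α → Bool × ℝ≥0
  finite_S : S.Finite
  finite_E : E.Finite
  nil_mem_S : [] ∈ S
  nil_mem_E : [] ∈ E
  hi_S : ∀ s ∈ S, IsHIWord s
  hi_E : ∀ e ∈ E, IsHIWord e
  prefix_S : ∀ s ∈ S, ∀ v, v <+: s → v ∈ S
  suffix_E : ∀ e ∈ E, ∀ v, v <:+ e → v ∈ E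
  range_entry : ∀ s e, (s, e) ∈ cells K S E →
    IsHalfInt (entry s e).2 ∧ ¬ IsPosInt (entry s e).2
  entry_default : ∀ s e, (s, e) ∉ cells K S E → entry s e = (false, 0)

/-- The constraint `φ_K(t)` denoting the `K`-region of `t`. -/
noncomputable def regionGuard (K : ℕ) (t : ℝ≥0) : ClockConstraint :=
  open Classical in
  if t ≤ (K : ℝ≥0) then
    if (⌊t⌋₊ : ℝ≥0) = t then .eq ⌊t⌋₊ else .and (.gt ⌊t⌋₊) (.lt ⌈t⌉₊)
  else .gt K

theorem sigmaK_finite (α : Type u) [Finite α] (K : ℕ) : (sigmaK α K).Finite := by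
  refine Set.Finite.subset
    (((Set.finite_lt_nat (2 * (K + 1))).image fun k : ℕ => (k : ℝ≥0) / 2).prod
      (Set.finite_univ (α := α))) ?_
  rintro ⟨t, a⟩ ⟨⟨k, hk⟩, hlt⟩
  refine ⟨⟨k, ?_, hk.symm⟩, Set.mem_univ _⟩
  simp only at hk hlt
  rw [hk, div_lt_iff₀ (by norm_num)] at hlt
  have : (k : ℝ≥0) < ((2 * (K + 1) : ℕ) : ℝ≥0) := by
    push_cast
    rwa [mul_comm]
  exact_mod_cast this

namespace ObsTable

variable {α : Type u}

/-- The row of `s`. -/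
def row (T : ObsTable α) (s : TimedWord α) : T.E → Bool × ℝ≥0 := fun e => T.entry s e

/-- `r(s) = r(s, ε)`, where `r` is the reset assignment of `T`. -/
def r (T : ObsTable α) (s : TimedWord α) : ℝ≥0 := (T.entry s []).2

def Closed (T : ObsTable α) : Prop :=
  ∀ w ∈ extensions T.K T.S, ∃ s ∈ T.S, T.row w = T.row s

def ConsistentA (T : ObsTable α) : Prop :=
  ∀ s₁ ∈ T.S, ∀ s₂ ∈ T.S, T.row s₁ = T.row s₂ →
    ∀ p ∈ sigmaK α T.K, T.row (s₁ ++ [p]) = T.row (s₂ ++ [p])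

def ConsistentB (T : ObsTable α) : Prop :=
  ∀ (s : TimedWord α) (t : ℝ≥0) (a : α), s ++ [(t, a)] ∈ T.S ∪ extensions T.K T.S →
    (T.K : ℝ≥0) < T.r s + t →
      T.row (s ++ [(t, a)]) = T.row (s ++ [((T.K : ℝ≥0) + 1 / 2, a)])

/-- The reset assignment has range in `[0, K]` (it never takes a positive integral value). -/
def Valid (T : ObsTable α) : Prop :=
  ∀ s e, (s, e) ∈ cells T.K T.S T.E → (T.entry s e).2 ≤ (T.K : ℝ≥0)

/-- Closed, consistent and valid. -/
def Ready (T : ObsTable α) : Prop :=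
  T.Closed ∧ T.ConsistentA ∧ T.ConsistentB ∧ T.Valid

open Classical in
/-- The conjecture `A_T`. -/
noncomputable def conj [Finite α] (T : ObsTable α) : OneTA α where
  Q := T.row '' T.S
  finite_Q := (T.finite_S.image T.row).to_subtype
  init := ⟨T.row [], Set.mem_image_of_mem _ T.nil_mem_S⟩
  trans := {θ | ∃ s ∈ T.S, ∃ s' ∈ T.S, ∃ p ∈ sigmaK α T.K,
    T.row (s ++ [p]) = T.row s' ∧
    θ.src.1 = T.row s ∧ θ.tgt.1 = T.row s' ∧ θ.letter = p.2 ∧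
    θ.guard = regionGuard T.K (T.r s + p.1) ∧ θ.keep = !decide (T.r s' = 0)}
  finite_trans := by
    have : Finite (T.S) := T.finite_S.to_subtype
    have : Finite (sigmaK α T.K) := (sigmaK_finite α T.K).to_subtype
    refine Set.Finite.subset (Set.finite_range
      (fun x : T.S × T.S × sigmaK α T.K =>
        (⟨⟨T.row x.1, Set.mem_image_of_mem _ x.1.2⟩, ⟨T.row x.2.1, Set.mem_image_of_mem _ x.2.1.2⟩,
          x.2.2.1.2, regionGuard T.K (T.r x.1 + x.2.2.1.1), !decide (T.r x.2.1 = 0)⟩ :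
          ClockTransition α (T.row '' T.S)))) ?_
    rintro ⟨⟨q, hq⟩, ⟨q', hq'⟩, a, g, d⟩ ⟨s, hs, s', hs', p, hp, -, h1, h2, h3, h4, h5⟩
    refine ⟨⟨⟨s, hs⟩, ⟨s', hs'⟩, ⟨p, hp⟩⟩, ?_⟩
    simp only at h1 h2 h3 h4 h5
    subst h1 h2 h3 h4 h5
    rfl
  final := {q | (q.1 ⟨[], T.nil_mem_E⟩).1 = true}

/-- `T.Action K' S' E'`: one of the four actions of the processing procedure applies to `T`, and
turns the parameters `(K, S, E)` of `T` into `(K', S', E')`. -/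
inductive Action (T : ObsTable α) : ℕ → Set (TimedWord α) → Set (TimedWord α) → Prop
  | close (w : TimedWord α) (hw : w ∈ extensions T.K T.S)
      (hne : ∀ s ∈ T.S, T.row w ≠ T.row s) :
      Action T T.K (T.S ∪ {w}) T.E
  | distinguish (s₁ s₂ : TimedWord α) (p : ℝ≥0 × α) (e : TimedWord α)
      (hs₁ : s₁ ∈ T.S) (hs₂ : s₂ ∈ T.S) (hp : p ∈ sigmaK α T.K) (he : e ∈ T.E)
      (hrow : T.row s₁ = T.row s₂) (hne : T.entry (s₁ ++ [p]) e ≠ T.entry (s₂ ++ [p]) e) :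
      Action T T.K T.S (T.E ∪ {p :: e})
  | enlarge (h : ¬ T.ConsistentB) : Action T (T.K + 1) T.S T.E
  | validate (s e : TimedWord α) (hse : (s, e) ∈ cells T.K T.S T.E)
      (h : (T.K : ℝ≥0) < (T.entry s e).2) :
      Action T (T.K + 1) T.S T.E

/-- The first components of the entries of `T` are the answers to the membership queries for `L`,
and the second components form a possible reset assignment, that is, the values on the words `se`
of some reset function without positive integral values. -/
def Filled (L : Set (TimedWord α)) (T : ObsTable α) : Prop :=
  (∀ s e, (s, e) ∈ cells T.K T.S T.E → ((T.entry s e).1 = true ↔ s ++ e ∈ L)) ∧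
  ∃ R : TimedWord α → ℝ≥0, IsStrictResetFunction R ∧
    ∀ s e, (s, e) ∈ cells T.K T.S T.E → (T.entry s e).2 = R (s ++ e)

/-- The tables with parameters `(K', S', E')`, one for each possible reset assignment that extends
the one of `T`. -/
def copies (L : Set (TimedWord α)) (T : ObsTable α) (K' : ℕ) (S' E' : Set (TimedWord α)) :
    Set (ObsTable α) :=
  {T' | T'.K = K' ∧ T'.S = S' ∧ T'.E = E' ∧ T'.Filled L ∧
    ∀ s e, (s, e) ∈ cells T.K T.S T.E → T'.entry s e = T.entry s e}

/-- The cells that are new in a table with parameters `(K', S', E')` built from `T`. -/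
def newCells (T : ObsTable α) (K' : ℕ) (S' E' : Set (TimedWord α)) :
    Set (TimedWord α × TimedWord α) :=
  cells K' S' E' \ cells T.K T.S T.E

/-- The row words after processing the counterexample `w`: all prefixes of all possible normal
forms of `w` are added. -/
def refineRows (T : ObsTable α) (w : TimedWord α) : Set (TimedWord α) :=
  T.S ∪ {v | ∃ x ∈ normalForms w, v <+: x}

end ObsTable

/-! ### The Normal Teacher algorithm -/

/-- A state of the algorithm: the tables of the current pool `P_i` that remain to be processed, the
part of `P_{i+1}` built so far, the number of tables processed, the number of membership queries
asked, the length of the longest counterexample received (`0` if none), and the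
automaton returned, if any. -/
structure LearnState (α : Type u) : Type (u + 1) where
  pool : Set (ObsTable α)
  next : Set (ObsTable α)
  processed : ℕ
  queries : ℕ∞
  longest : ℕ
  result : Option (OneTA α)

/-- The initial state: the pool `P₀` holds one table with `K = 0` and `S = E = {ε}` for each
possible reset assignment; one membership query has been asked for each cell. -/
noncomputable def LearnState.initial {α : Type u} (L : Set (TimedWord α)) : LearnState α where
  pool := {T | T.K = 0 ∧ T.S = {[]} ∧ T.E = {[]} ∧ T.Filled L}
  next := ∅
  processed := 0
  queries := (cells (α := α) 0 {[]} {[]}).encard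
  longest := 0
  result := none

/-- One step of the algorithm for the unknown language `L`. All choices are left open: the
table picked in the pool, the action applied to it, and the counterexample of the Teacher. -/
inductive LearnStep {α : Type u} [Finite α] (L : Set (TimedWord α)) :
    LearnState α → LearnState α → Prop
  /-- A table that is not closed, consistent and valid is processed by a single action. -/
  | act (st : LearnState α) (hres : st.result = none) (T : ObsTable α) (hT : T ∈ st.pool)
      (hready : ¬ T.Ready) (K' : ℕ) (S' E' : Set (TimedWord α)) (haction : T.Action K' S' E') :
      LearnStep L st
        { pool := st.pool \ {T}
          next := st.next ∪ T.copies L K' S' E'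
          processed := st.processed + 1
          queries := st.queries + (T.newCells K' S' E').encard
          longest := st.longest
          result := none }
  /-- The Teacher refutes the conjecture with the counterexample `w`. -/
  | refute (st : LearnState α) (hres : st.result = none) (T : ObsTable α) (hT : T ∈ st.pool)
      (hready : T.Ready) (w : TimedWord α) (hw : ¬ (w ∈ T.conj.lang ↔ w ∈ L)) :
      LearnStep L st
        { pool := st.pool \ {T}
          next := st.next ∪ T.copies L T.K (T.refineRows w) T.E
          processed := st.processed + 1
          queries := st.queries + (T.newCells T.K (T.refineRows w) T.E).encard
          longest := max st.longest w.length
          result := none }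
  /-- The Teacher confirms the conjecture, which is returned. -/
  | confirm (st : LearnState α) (hres : st.result = none) (T : ObsTable α) (hT : T ∈ st.pool)
      (hready : T.Ready) (hL : T.conj.lang = L) :
      LearnStep L st
        { pool := st.pool \ {T}
          next := st.next
          processed := st.processed + 1
          queries := st.queries
          longest := st.longest
          result := some T.conj }
  /-- The current pool is exhausted, and the next one takes its place. -/
  | advance (st : LearnState α) (hres : st.result = none) (hpool : st.pool = ∅) :
      LearnStep L st { st with pool := st.next, next := ∅ }

/-!
Call a reset function strict if it never takes a positive integer value, and a machine strict if its
clock is given by a strict reset function. The syntactic reset function `R^L` is the clock of a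
strict machine with constant `K_L` that resets as soon as the residual language allows it. This
works by rigidity: if configurations of two strict machines accept the same language at clock values
whose difference is not an integer, then this language does not change when a clock value moves
within its region. Hence half-integral words with the same value of `R^L` and the same residual
language stay interchangeable, and a table filled with `R^L` has at most `n` different rows.

Every pool contains a table filled with `R^L`, because one of the copies of such a table has its new
cells filled with `R^L` as well. Its level, the constant plus the number of different rows, is at
most `H = K_L + n`. An action raises the level. A counterexample does not lower it and leaves a
table that is not ready, because a conjecture that computes `R^L` and the right final states on all
normal forms of a word decides this word correctly. Hence there are fewer than `2H` pools.

Each cell has at most two possible reset values, zero and one other: if `R (w (t·a))` is positive,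
then it is `R w + t` and not an integer, so whether `t` is an integer tells whether `R w` is zero,
and if not, `R w` is known by induction. So if a table with `k` cells weighs `2⁻ᵏ`, its copies
together weigh at most as much as the table itself. Every pool therefore starts with total weight at
most one, and contains at most `2ᴰ` tables if these have at most `D` cells.
-/

/-! ### Regions and half-integers -/

/-- `x` is not a natural number. -/
def IsNonInt (x : ℝ≥0) : Prop := ∀ k : ℕ, x ≠ k

/-- The position of the `K`-region of `y` in the list `{0}, (0, 1), {1}, …, {K}, (K, ∞)`; the region
at an even position `2c` is `{c}`. -/
noncomputable def regionIndex (K : ℕ) (y : ℝ≥0) : ℕ := min (⌊y⌋₊ + ⌈y⌉₊) (2 * K + 1)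

section FloorCeil

variable {K c d : ℕ} {x y z : ℝ≥0}

theorem floor_eq_self_iff : (⌊x⌋₊ : ℝ≥0) = x ↔ ⌈x⌉₊ ≤ ⌊x⌋₊ := by
  rw [Nat.ceil_le]
  exact ⟨ge_of_eq, (Nat.floor_le zero_le).antisymm⟩

theorem eq_natCast_iff_floor_ceil : x = c ↔ ⌊x⌋₊ = c ∧ ⌈x⌉₊ = c := by
  constructor
  · rintro rfl
    exact ⟨Nat.floor_natCast c, Nat.ceil_natCast c⟩
  · rintro ⟨hfloor, hceil⟩
    rw [← hfloor, floor_eq_self_iff.2 (hceil.trans hfloor.symm).le]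

theorem isNonInt_iff_floor_lt_ceil : IsNonInt x ↔ ⌊x⌋₊ < ⌈x⌉₊ := by
  rw [← not_le, ← floor_eq_self_iff]
  exact ⟨fun h h' => h _ h'.symm, fun h k hk => h (by simp [hk])⟩

theorem IsNonInt.ne_zero (h : IsNonInt x) : x ≠ 0 := by simpa using h 0

theorem isNonInt_add_natCast : IsNonInt (x + d) ↔ IsNonInt x := by
  simp only [isNonInt_iff_floor_lt_ceil, Nat.floor_add_natCast zero_le,
    Nat.ceil_add_natCast zero_le, add_lt_add_iff_right]

theorem not_isPosInt_iff : ¬ IsPosInt x ↔ x = 0 ∨ IsNonInt x := by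
  constructor
  · intro h
    refine or_iff_not_imp_left.2 fun h0 k hk => h ⟨k, ?_, hk⟩
    exact Nat.pos_of_ne_zero fun hk0 => h0 (by simp [hk, hk0])
  · rintro (rfl | h) ⟨k, hk, hx⟩
    · exact hk.ne (by exact_mod_cast hx)
    · exact h k hx

end FloorCeil

theorem kRegionEquiv_iff_regionIndex {K : ℕ} {y z : ℝ≥0} :
    KRegionEquiv K y z ↔ regionIndex K y = regionIndex K z := by
  have hy := Nat.floor_le_ceil y
  have hz := Nat.floor_le_ceil z
  have hy' := Nat.ceil_le_floor_add_one y
  have hz' := Nat.ceil_le_floor_add_one z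
  rw [KRegionEquiv, RegionEquiv, floor_eq_self_iff, floor_eq_self_iff, ← Nat.lt_ceil,
    ← Nat.lt_ceil, regionIndex, regionIndex]
  omega

theorem regionIndex_mono (K : ℕ) : Monotone (regionIndex K) := fun _ _ h =>
  min_le_min_right _ (add_le_add (Nat.floor_mono h) (Nat.ceil_mono h))

theorem regionIndex_lt (K : ℕ) (y : ℝ≥0) : regionIndex K y < 2 * K + 2 :=
  Nat.lt_succ_of_le (min_le_right _ _)

namespace KRegionEquiv

variable {K : ℕ} {x y z : ℝ≥0}

theorem refl (K : ℕ) (y : ℝ≥0) : KRegionEquiv K y y := kRegionEquiv_iff_regionIndex.2 rfl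

theorem symm (h : KRegionEquiv K y z) : KRegionEquiv K z y :=
  kRegionEquiv_iff_regionIndex.2 (kRegionEquiv_iff_regionIndex.1 h).symm

theorem trans (h : KRegionEquiv K x y) (h' : KRegionEquiv K y z) : KRegionEquiv K x z :=
  kRegionEquiv_iff_regionIndex.2
    ((kRegionEquiv_iff_regionIndex.1 h).trans (kRegionEquiv_iff_regionIndex.1 h'))

theorem of_between (h : KRegionEquiv K x z) (hxy : x ≤ y) (hyz : y ≤ z) : KRegionEquiv K x y := by
  rw [kRegionEquiv_iff_regionIndex] at h ⊢
  exact (regionIndex_mono K hxy).antisymm (h ▸ regionIndex_mono K hyz)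

theorem of_gt (hy : (K : ℝ≥0) < y) (hz : (K : ℝ≥0) < z) : KRegionEquiv K y z := Or.inr ⟨hy, hz⟩

theorem exists_add (h : KRegionEquiv K y z) (t : ℝ≥0) : ∃ s, KRegionEquiv K (y + s) (z + t) := by
  rcases le_total y (z + t) with hy | hy
  · exact ⟨z + t - y, by rw [add_tsub_cancel_of_le hy]; exact .refl K _⟩
  · refine ⟨0, ?_⟩
    rw [add_zero]
    exact h.trans (h.symm.of_between le_self_add hy)

theorem min_ceil_eq (h : KRegionEquiv K y z) : min ⌈y⌉₊ (K + 1) = min ⌈z⌉₊ (K + 1) := by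
  have hy := Nat.floor_le_ceil y
  have hz := Nat.floor_le_ceil z
  have hy' := Nat.ceil_le_floor_add_one y
  have hz' := Nat.ceil_le_floor_add_one z
  rw [kRegionEquiv_iff_regionIndex, regionIndex, regionIndex] at h
  omega

theorem le_iff (h : KRegionEquiv K y z) : y ≤ K ↔ z ≤ K := by
  have := h.min_ceil_eq
  rw [← Nat.ceil_le, ← Nat.ceil_le]
  omega

theorem floor_eq (h : KRegionEquiv K y z) (hy : y ≤ K) : ⌊y⌋₊ = ⌊z⌋₊ :=
  (h.resolve_right fun h' => h'.1.not_ge hy).1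

theorem ceil_eq (h : KRegionEquiv K y z) (hy : y ≤ K) : ⌈y⌉₊ = ⌈z⌉₊ := by
  have := h.min_ceil_eq
  have := Nat.ceil_le.2 hy
  omega

theorem isNonInt_iff (h : KRegionEquiv K y z) (hy : y ≤ K) : IsNonInt y ↔ IsNonInt z := by
  rw [isNonInt_iff_floor_lt_ceil, isNonInt_iff_floor_lt_ceil, h.floor_eq hy, h.ceil_eq hy]

theorem add_natCast (h : KRegionEquiv K y z) (d : ℕ) : KRegionEquiv K (y + d) (z + d) := by
  rw [kRegionEquiv_iff_regionIndex, regionIndex, regionIndex] at h ⊢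
  simp only [Nat.floor_add_natCast zero_le, Nat.ceil_add_natCast zero_le]
  omega

theorem mem_denote_iff (h : KRegionEquiv K y z) {φ : ClockConstraint} (hφ : φ.maxConst ≤ K) :
    y ∈ φ.denote ↔ z ∈ φ.denote := by
  have hy := Nat.floor_le_ceil y
  have hz := Nat.floor_le_ceil z
  have hy' := Nat.ceil_le_floor_add_one y
  have hz' := Nat.ceil_le_floor_add_one z
  rw [kRegionEquiv_iff_regionIndex, regionIndex, regionIndex] at h
  induction φ with
  | gt c =>
      simp only [ClockConstraint.maxConst] at hφ
      simp only [ClockConstraint.denote, Set.mem_ofPred_eq, ← Nat.lt_ceil]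
      omega
  | eq c =>
      simp only [ClockConstraint.maxConst] at hφ
      simp only [ClockConstraint.denote, Set.mem_ofPred_eq, eq_natCast_iff_floor_ceil]
      omega
  | lt c =>
      simp only [ClockConstraint.maxConst] at hφ
      simp only [ClockConstraint.denote, Set.mem_ofPred_eq, ← Nat.floor_lt zero_le]
      omega
  | and φ ψ ihφ ihψ =>
      exact and_congr (ihφ (le_of_max_le_left hφ)) (ihψ (le_of_max_le_right hφ))

end KRegionEquiv

theorem kRegionEquiv_zero_iff {K : ℕ} {z : ℝ≥0} : KRegionEquiv K 0 z ↔ z = 0 := by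
  refine ⟨fun h => ?_, fun h => h ▸ .refl K 0⟩
  simpa using (h.ceil_eq zero_le).symm

theorem mem_regionGuard {K : ℕ} {y z : ℝ≥0} :
    z ∈ (regionGuard K y).denote ↔ KRegionEquiv K y z := by
  have hy := Nat.floor_le_ceil y
  have hz := Nat.floor_le_ceil z
  have hy' := Nat.ceil_le_floor_add_one y
  have hz' := Nat.ceil_le_floor_add_one z
  rw [kRegionEquiv_iff_regionIndex, regionIndex, regionIndex, regionGuard]
  simp only [← Nat.ceil_le, floor_eq_self_iff]
  split_ifs
  · simp only [ClockConstraint.denote, Set.mem_ofPred_eq, eq_natCast_iff_floor_ceil]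
    omega
  · simp only [ClockConstraint.denote, Set.mem_inter_iff, Set.mem_ofPred_eq, ← Nat.lt_ceil,
      ← Nat.floor_lt zero_le]
    omega
  · simp only [ClockConstraint.denote, Set.mem_ofPred_eq, ← Nat.lt_ceil]
    omega

theorem denote_regionGuard (K : ℕ) (y : ℝ≥0) :
    (regionGuard K y).denote = {z | KRegionEquiv K y z} :=
  Set.ext fun _ => mem_regionGuard

theorem KRegionEquiv.regionGuard_eq {K : ℕ} {y z : ℝ≥0} (h : KRegionEquiv K y z) :
    regionGuard K y = regionGuard K z := by
  by_cases hy : y ≤ K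
  · have hz := h.le_iff.1 hy
    have hint : (⌊y⌋₊ : ℝ≥0) = y ↔ (⌊z⌋₊ : ℝ≥0) = z := by
      rw [floor_eq_self_iff, floor_eq_self_iff, h.floor_eq hy, h.ceil_eq hy]
    simp only [regionGuard, if_pos hy, if_pos hz, hint]
    rw [h.floor_eq hy, h.ceil_eq hy]
  · have hz : ¬ z ≤ K := fun hz => hy (h.le_iff.2 hz)
    simp only [regionGuard, hy, hz, if_false]

theorem maxConst_regionGuard_le (K : ℕ) (y : ℝ≥0) : (regionGuard K y).maxConst ≤ K := by
  unfold regionGuard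
  split_ifs with hK
  · exact Nat.floor_le_of_le hK
  · exact max_le (Nat.floor_le_of_le hK) (Nat.ceil_le.2 hK)
  · exact le_rfl

theorem IsNonInt.eventually_regionEquiv {x : ℝ≥0} (h : IsNonInt x) :
    ∀ᶠ y in nhds x, RegionEquiv x y := by
  rw [isNonInt_iff_floor_lt_ceil] at h
  have hceil := Nat.ceil_le_floor_add_one x
  filter_upwards [lt_mem_nhds (Nat.lt_ceil.1 h), gt_mem_nhds (Nat.lt_floor_add_one x)]
    with y hy hy'
  have hfloor : ⌊y⌋₊ = ⌊x⌋₊ := (Nat.floor_eq_iff zero_le).2 ⟨hy.le, hy'⟩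
  rw [← Nat.lt_ceil] at hy
  rw [RegionEquiv, floor_eq_self_iff, floor_eq_self_iff]
  omega

section HalfIntegers

variable {K : ℕ} {x y z : ℝ≥0}

theorem hi_eq_floor_add_ceil (x : ℝ≥0) : hi x = ((⌊x⌋₊ + ⌈x⌉₊ : ℕ) : ℝ≥0) / 2 := by
  have hfloor := Nat.floor_le_ceil x
  have hceil := Nat.ceil_le_floor_add_one x
  simp only [hi, floor_eq_self_iff]
  split_ifs with h
  · have hx : ⌈x⌉₊ = ⌊x⌋₊ := h.antisymm hfloor
    rw [hx, ← floor_eq_self_iff.2 h, Nat.floor_natCast]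
    push_cast
    ring
  · have hx : ⌈x⌉₊ = ⌊x⌋₊ + 1 := by omega
    rw [hx]
    push_cast
    ring

theorem isHalfInt_hi (x : ℝ≥0) : IsHalfInt (hi x) := ⟨_, hi_eq_floor_add_ceil x⟩

theorem hi_mono : Monotone hi := fun x y hxy => by
  rw [hi_eq_floor_add_ceil, hi_eq_floor_add_ceil]
  gcongr

theorem hi_eq_zero_iff : hi x = 0 ↔ x = 0 := by
  rw [hi_eq_floor_add_ceil, div_eq_zero_iff, Nat.cast_eq_zero, Nat.add_eq_zero_iff,
    Nat.ceil_eq_zero, nonpos_iff_eq_zero]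
  simp +contextual

theorem floor_add_ceil_div_two (k : ℕ) : ⌊(k / 2 : ℝ≥0)⌋₊ + ⌈(k / 2 : ℝ≥0)⌉₊ = k := by
  obtain ⟨c, rfl | rfl⟩ := k.even_or_odd'
  · have hc : ((2 * c : ℕ) / 2 : ℝ≥0) = c := by
      push_cast
      field_simp
    rw [hc, Nat.floor_natCast, Nat.ceil_natCast, two_mul]
  · have hc : ((2 * c + 1 : ℕ) / 2 : ℝ≥0) = 1 / 2 + c := by
      push_cast
      field_simp
      ring
    have hceil : ⌈(1 / 2 : ℝ≥0)⌉₊ = 1 := (Nat.ceil_eq_iff one_ne_zero).2 (by norm_num)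
    have hfloor : ⌊(1 / 2 : ℝ≥0)⌋₊ = 0 := Nat.floor_eq_zero.2 (NNReal.half_lt_self one_ne_zero)
    rw [hc, Nat.floor_add_natCast zero_le, Nat.ceil_add_natCast zero_le, hceil, hfloor]
    ring

theorem IsHalfInt.hi_eq (h : IsHalfInt x) : hi x = x := by
  obtain ⟨k, rfl⟩ := h
  rw [hi_eq_floor_add_ceil, floor_add_ceil_div_two]

theorem regionIndex_div_two {k : ℕ} (hk : k < 2 * K + 2) : regionIndex K (k / 2) = k := by
  rw [regionIndex, floor_add_ceil_div_two]
  omega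

theorem kRegionEquiv_regionIndex_div_two (K : ℕ) (y : ℝ≥0) :
    KRegionEquiv K (regionIndex K y / 2) y :=
  kRegionEquiv_iff_regionIndex.2 (regionIndex_div_two (regionIndex_lt K y))

theorem kRegionEquiv_hi (K : ℕ) (x : ℝ≥0) : KRegionEquiv K x (hi x) := by
  rw [kRegionEquiv_iff_regionIndex, hi_eq_floor_add_ceil, regionIndex, regionIndex,
    floor_add_ceil_div_two]

theorem IsHalfInt.add (hx : IsHalfInt x) (hy : IsHalfInt y) : IsHalfInt (x + y) := by
  obtain ⟨j, rfl⟩ := hx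
  obtain ⟨k, rfl⟩ := hy
  exact ⟨j + k, by push_cast; rw [add_div]⟩

theorem IsHalfInt.tsub (hx : IsHalfInt x) (hy : IsHalfInt y) : IsHalfInt (x - y) := by
  obtain ⟨j, rfl⟩ := hx
  obtain ⟨k, rfl⟩ := hy
  exact ⟨j - k, by rw [← NNReal.sub_div, Nat.cast_tsub]⟩

theorem isHalfInt_natCast (k : ℕ) : IsHalfInt (k : ℝ≥0) := ⟨2 * k, by push_cast; field_simp⟩

theorem isHalfInt_zero : IsHalfInt 0 := ⟨0, by simp⟩

theorem IsHalfInt.eq_of_kRegionEquiv (hy : IsHalfInt y) (hz : IsHalfInt z)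
    (h : KRegionEquiv K y z) (hyK : y ≤ K) : y = z := by
  rw [← hy.hi_eq, ← hz.hi_eq, hi_eq_floor_add_ceil, hi_eq_floor_add_ceil, h.floor_eq hyK,
    h.ceil_eq hyK]

theorem IsHalfInt.mem_sigmaK_of_le {α : Type u} (h : IsHalfInt x) (hx : x ≤ K) (a : α) :
    (x, a) ∈ sigmaK α K :=
  ⟨h, hx.trans_lt (lt_add_of_pos_right _ one_pos)⟩

theorem natCast_add_half_mem_sigmaK {α : Type u} (K : ℕ) (a : α) :
    ((K : ℝ≥0) + 1 / 2, a) ∈ sigmaK α K :=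
  ⟨(isHalfInt_natCast K).add ⟨1, by norm_num⟩, by simpa using NNReal.half_lt_self one_ne_zero⟩

end HalfIntegers

/-! ### Runs of automata and of region machines -/

namespace OneTA

variable {α : Type u} {A : OneTA α}

/-- `θ` is a transition of `A` that can be taken in state `q` on the letter `a` when the clock
shows `y`. -/
def Enabled (A : OneTA α) (q : A.Q) (a : α) (y : ℝ≥0) (θ : ClockTransition α A.Q) : Prop :=
  θ ∈ A.trans ∧ θ.src = q ∧ θ.letter = a ∧ y ∈ θ.guard.denote

/-- The words accepted from the configuration `(q, ν)`. -/
def langFrom (A : OneTA α) (q : A.Q) (ν : ℝ≥0) : Set (TimedWord α) :=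
  {w | ∃ θs q' ν', A.Run q ν w θs q' ν' ∧ q' ∈ A.final}

variable {q q' : A.Q} {ν ν' t y : ℝ≥0} {a : α} {w : TimedWord α}
  {θ θ' : ClockTransition α A.Q} {θs : List (ClockTransition α A.Q)}

theorem run_nil_iff : A.Run q ν [] θs q' ν' ↔ θs = [] ∧ q' = q ∧ ν' = ν := by
  constructor
  · rintro ⟨⟩
    exact ⟨rfl, rfl, rfl⟩
  · rintro ⟨rfl, rfl, rfl⟩
    exact .nil _ _

theorem run_cons_iff :
    A.Run q ν ((t, a) :: w) θs q' ν' ↔ ∃ θ θs', θs = θ :: θs' ∧ A.Enabled q a (ν + t) θ ∧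
      A.Run θ.tgt (if θ.keep then ν + t else 0) w θs' q' ν' := by
  constructor
  · rintro ⟨⟩
    exact ⟨_, _, rfl, ⟨‹_›, rfl, rfl, ‹_›⟩, ‹_›⟩
  · rintro ⟨θ, θs', rfl, ⟨hθ, rfl, rfl, hguard⟩, hrun⟩
    exact .cons θ ν t w θs' q' ν' hθ hguard hrun

theorem nil_mem_langFrom : [] ∈ A.langFrom q ν ↔ q ∈ A.final := by
  simp only [langFrom, Set.mem_ofPred_eq, run_nil_iff]
  exact ⟨fun ⟨_, _, _, ⟨_, hq, _⟩, hfinal⟩ => hq ▸ hfinal, fun h => ⟨_, _, _, ⟨rfl, rfl, rfl⟩, h⟩⟩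

theorem cons_mem_langFrom : (t, a) :: w ∈ A.langFrom q ν ↔
    ∃ θ, A.Enabled q a (ν + t) θ ∧ w ∈ A.langFrom θ.tgt (if θ.keep then ν + t else 0) := by
  simp only [langFrom, Set.mem_ofPred_eq, run_cons_iff]
  constructor
  · rintro ⟨_, q', ν', ⟨θ, θs, -, henabled, hrun⟩, hq'⟩
    exact ⟨θ, henabled, θs, q', ν', hrun, hq'⟩
  · rintro ⟨θ, henabled, θs, q', ν', hrun, hq'⟩
    exact ⟨_, q', ν', ⟨θ, θs, rfl, henabled, hrun⟩, hq'⟩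

theorem IsDeterministic.enabled_unique (hA : A.IsDeterministic) (h : A.Enabled q a y θ)
    (h' : A.Enabled q a y θ') : θ = θ' := by
  obtain ⟨hθ, rfl, rfl, hguard⟩ := h
  obtain ⟨hθ', hsrc, hletter, hguard'⟩ := h'
  by_contra hne
  rcases hA θ hθ θ' hθ' hne with h | h | h
  · exact h hsrc.symm
  · exact h hletter.symm
  · exact Set.disjoint_left.1 h hguard hguard'

theorem maxConst_guard_le (hθ : θ ∈ A.trans) : θ.guard.maxConst ≤ A.maxConst :=
  le_csSup (A.finite_trans.image _).bddAbove ⟨θ, hθ, rfl⟩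

end OneTA

/-- A deterministic and complete one-clock machine whose moves depend only on the `K`-region of the
clock value. The second component of a move tells whether the clock is kept. No initial state is
fixed, so that residuals of the language of a machine are languages of the same machine. -/
structure RegionMachine (α : Type u) (K : ℕ) : Type (u + 1) where
  State : Type u
  finite_State : Finite State
  step : State → α → ℝ≥0 → State × Bool
  final : Set State
  step_congr : ∀ q a {y z}, KRegionEquiv K y z → step q a y = step q a z

namespace RegionMachine

variable {α : Type u} {K : ℕ} (M : RegionMachine α K)

/-- The configuration reached from `c` by reading one timed letter. -/
def next (c : M.State × ℝ≥0) (p : ℝ≥0 × α) : M.State × ℝ≥0 :=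
  ((M.step c.1 p.2 (c.2 + p.1)).1, if (M.step c.1 p.2 (c.2 + p.1)).2 then c.2 + p.1 else 0)

/-- The configuration reached from `c` by reading a timed word. -/
def run (c : M.State × ℝ≥0) (w : TimedWord α) : M.State × ℝ≥0 := w.foldl M.next c

/-- The words accepted from the configuration `c`. -/
def langFrom (c : M.State × ℝ≥0) : Set (TimedWord α) := {w | (M.run c w).1 ∈ M.final}

/-- The clock is kept only at nonintegral values below `K`. -/
def IsStrict : Prop := ∀ q a y, (M.step q a y).2 = true → y ≤ K ∧ IsNonInt y

variable {M} {q : M.State} {c : M.State × ℝ≥0} {ν ν' y z : ℝ≥0} {a : α}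

theorem cons_mem_langFrom {p : ℝ≥0 × α} {w : TimedWord α} :
    p :: w ∈ M.langFrom c ↔ w ∈ M.langFrom (M.next c p) := Iff.rfl

theorem run_snoc (c : M.State × ℝ≥0) (w : TimedWord α) (p : ℝ≥0 × α) :
    M.run c (w ++ [p]) = M.next (M.run c w) p := by
  simp only [run, List.foldl_append, List.foldl_cons, List.foldl_nil]

theorem residualLang_langFrom (c : M.State × ℝ≥0) (u : TimedWord α) :
    residualLang (M.langFrom c) u = M.langFrom (M.run c u) := by
  ext w
  simp only [residualLang, langFrom, run, Set.mem_ofPred_eq, List.foldl_append]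

theorem langFrom_eq_of_gt (hν : K < ν) (hν' : K < ν') : M.langFrom (q, ν) = M.langFrom (q, ν') := by
  ext w
  induction w generalizing q ν ν' with
  | nil => rfl
  | cons p w ih =>
      have hy : K < ν + p.1 := hν.trans_le le_self_add
      have hz : K < ν' + p.1 := hν'.trans_le le_self_add
      rw [cons_mem_langFrom, cons_mem_langFrom, next, next, M.step_congr q p.2 (.of_gt hy hz)]
      split_ifs
      · exact ih hy hz
      · rfl

section OfOneTA

variable (A : OneTA α)

open Classical in
/-- The completion of an automaton by a sink state. -/
noncomputable abbrev ofOneTA : RegionMachine α A.maxConst where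
  State := Option A.Q
  finite_State := have := A.finite_Q; inferInstance
  step x a y := x.elim (none, false) fun q =>
    if h : ∃ θ, A.Enabled q a y θ then (some h.choose.tgt, h.choose.keep) else (none, false)
  final := some '' A.final
  step_congr x a y z h := by
    have henabled (q : A.Q) : A.Enabled q a y = A.Enabled q a z :=
      funext fun θ => propext <| and_congr_right fun hθ => by
        rw [h.mem_denote_iff (OneTA.maxConst_guard_le hθ)]
    simp only [henabled]

variable {A}

theorem langFrom_none (ν : ℝ≥0) : (ofOneTA A).langFrom ((none : Option A.Q), ν) = ∅ := by
  refine Set.eq_empty_iff_forall_notMem.2 fun w => ?_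
  induction w generalizing ν with
  | nil => exact fun ⟨_, _, h⟩ => Option.some_ne_none _ h
  | cons p _ ih => exact ih _

theorem langFrom_ofOneTA (hA : A.IsDeterministic) (q : A.Q) (ν : ℝ≥0) :
    (ofOneTA A).langFrom (some q, ν) = A.langFrom q ν := by
  ext w
  induction w generalizing q ν with
  | nil =>
      rw [OneTA.nil_mem_langFrom]
      exact Option.some_injective _ |>.mem_set_image
  | cons p w ih =>
      obtain ⟨t, a⟩ := p
      rw [OneTA.cons_mem_langFrom, cons_mem_langFrom]
      by_cases h : ∃ θ, A.Enabled q a (ν + t) θ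
      · have hnext : (ofOneTA A).next (some q, ν) (t, a) =
            (some h.choose.tgt, if h.choose.keep then ν + t else 0) := by
          simp only [next, ofOneTA, Option.elim_some, dif_pos h]
        rw [hnext, ih]
        refine ⟨fun hw => ⟨_, h.choose_spec, hw⟩, fun ⟨θ, hθ, hw⟩ => ?_⟩
        rwa [hA.enabled_unique h.choose_spec hθ]
      · have hnext : (ofOneTA A).next (some q, ν) (t, a) = (none, 0) := by
          simp only [next, ofOneTA, Option.elim_some, dif_neg h, Bool.false_eq_true, if_false]
        rw [hnext, langFrom_none]
        exact iff_of_false (Set.notMem_empty w) fun ⟨θ, hθ, _⟩ => h ⟨θ, hθ⟩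

end OfOneTA

section Strictify

open Classical in
/-- The machine that resets its clock at integral values and at values above `K`, and remembers
what has been subtracted; the amount `K + 1` stands for all clock values above `K`. -/
noncomputable abbrev strictify (M : RegionMachine α K) : RegionMachine α K where
  State := M.State × Fin (K + 2)
  finite_State := have := M.finite_State; inferInstance
  step x a y :=
    let z : ℝ≥0 := y + (x.2 : ℕ)
    let m := M.step x.1 a z
    if m.2 = false then ((m.1, 0), false)
    else if z ≤ K ∧ IsNonInt z then ((m.1, x.2), true)
    else ((m.1, ⟨min ⌈z⌉₊ (K + 1), by omega⟩), false)
  final := {x | x.1 ∈ M.final}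
  step_congr x a y z h := by
    have h' := h.add_natCast x.2
    have hkeep : y + (x.2 : ℕ) ≤ K ∧ IsNonInt (y + (x.2 : ℕ)) ↔
        z + (x.2 : ℕ) ≤ K ∧ IsNonInt (z + (x.2 : ℕ)) := by
      rw [← h'.le_iff]
      exact and_congr_right h'.isNonInt_iff
    simp only [M.step_congr x.1 a h', hkeep, h'.min_ceil_eq]

theorem isStrict_strictify (M : RegionMachine α K) : M.strictify.IsStrict := by
  rintro ⟨q, d⟩ a y h
  simp only [strictify] at h
  split_ifs at h with hreset hkeep
  exact ⟨le_self_add.trans hkeep.1, isNonInt_add_natCast.1 hkeep.2⟩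

theorem langFrom_min_ceil (hy : ¬ (y ≤ K ∧ IsNonInt y)) :
    M.langFrom (q, (min ⌈y⌉₊ (K + 1) : ℕ)) = M.langFrom (q, y) := by
  by_cases hyK : y ≤ K
  · have hceil : ⌈y⌉₊ ≤ ⌊y⌋₊ := by simpa [hyK, isNonInt_iff_floor_lt_ceil] using hy
    rw [min_eq_left ((Nat.ceil_le.2 hyK).trans K.le_succ), ← floor_eq_self_iff.2 hceil,
      Nat.ceil_natCast]
  · rw [not_le, ← Nat.lt_ceil] at hyK
    refine langFrom_eq_of_gt ?_ (Nat.lt_ceil.1 hyK)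
    exact_mod_cast lt_min hyK K.lt_succ_self

theorem langFrom_next_strictify (q : M.State) (d : Fin (K + 2)) (ν t : ℝ≥0) (a : α) :
    let c := M.strictify.next ((q, d), ν) (t, a)
    M.langFrom (c.1.1, c.2 + (c.1.2 : ℕ)) = M.langFrom (M.next (q, ν + (d : ℕ)) (t, a)) := by
  have hy : ν + t + (d : ℕ) = ν + (d : ℕ) + t := add_right_comm _ _ _
  cases hm : (M.step q a (ν + (d : ℕ) + t)).2
  · simp [next, hy, hm]
  · by_cases hkeep : ν + (d : ℕ) + t ≤ K ∧ IsNonInt (ν + (d : ℕ) + t)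
    · simp [next, hy, hm, hkeep]
    · simpa [next, hy, hm, hkeep] using langFrom_min_ceil hkeep

theorem langFrom_strictify (q : M.State) (d : Fin (K + 2)) (ν : ℝ≥0) :
    M.strictify.langFrom ((q, d), ν) = M.langFrom (q, ν + (d : ℕ)) := by
  ext w
  induction w generalizing q d ν with
  | nil => rfl
  | cons p w ih =>
      rw [cons_mem_langFrom, cons_mem_langFrom, ← langFrom_next_strictify]
      exact ih ..

end Strictify

section ToOneTA

variable [Finite α]

/-- The automaton of a machine with initial state `q₀`, with one transition for each `K`-region,
represented by half of its index. -/
noncomputable abbrev toOneTA (M : RegionMachine α K) (q₀ : M.State) : OneTA α where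
  Q := M.State
  finite_Q := M.finite_State
  init := q₀
  trans := Set.range fun i : M.State × α × Fin (2 * K + 2) =>
    let y : ℝ≥0 := (i.2.2 : ℕ) / 2
    ⟨i.1, (M.step i.1 i.2.1 y).1, i.2.1, regionGuard K y, (M.step i.1 i.2.1 y).2⟩
  finite_trans := have := M.finite_State; Set.finite_range _
  final := M.final

theorem enabled_toOneTA_iff {q₀ : M.State} {θ : ClockTransition α M.State} :
    (M.toOneTA q₀).Enabled q a y θ ↔
      θ = ⟨q, (M.step q a y).1, a, regionGuard K y, (M.step q a y).2⟩ := by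
  constructor
  · rintro ⟨⟨⟨q, a, i⟩, rfl⟩, rfl, rfl, hguard⟩
    have h := mem_regionGuard.1 hguard
    simp only [h.regionGuard_eq, M.step_congr q a h]
  · rintro rfl
    have h := kRegionEquiv_regionIndex_div_two K y
    refine ⟨⟨(q, a, ⟨_, regionIndex_lt K y⟩), ?_⟩, rfl, rfl, mem_regionGuard.2 (.refl K y)⟩
    simp only [h.regionGuard_eq, M.step_congr q a h]

theorem isDeterministic_toOneTA (M : RegionMachine α K) (q₀ : M.State) :
    (M.toOneTA q₀).IsDeterministic := by
  intro θ hθ θ' hθ' hne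
  contrapose! hne
  obtain ⟨hsrc, hletter, hguard⟩ := hne
  obtain ⟨y, hy, hy'⟩ := Set.not_disjoint_iff.1 hguard
  exact (enabled_toOneTA_iff.1 ⟨hθ, rfl, rfl, hy⟩).trans
    (enabled_toOneTA_iff.1 ⟨hθ', hsrc.symm, hletter.symm, hy'⟩).symm

theorem langFrom_toOneTA (q₀ q : M.State) (ν : ℝ≥0) :
    (M.toOneTA q₀).langFrom q ν = M.langFrom (q, ν) := by
  ext w
  induction w generalizing q ν with
  | nil => exact OneTA.nil_mem_langFrom
  | cons p w ih =>
      rw [OneTA.cons_mem_langFrom, cons_mem_langFrom]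
      simp only [enabled_toOneTA_iff, exists_eq_left, ih]
      rfl

theorem isDTARecognizable_langFrom (M : RegionMachine α K) (q : M.State) :
    IsDTARecognizable (M.langFrom (q, 0)) :=
  ⟨M.toOneTA q, M.isDeterministic_toOneTA q, langFrom_toOneTA q q 0⟩

end ToOneTA

end RegionMachine

section ExistsMachine

variable {α : Type u} {L : Set (TimedWord α)}

theorem OneTA.IsDeterministic.exists_isStrict_machine {A : OneTA α} (hA : A.IsDeterministic) :
    ∃ M : RegionMachine α A.maxConst, M.IsStrict ∧ ∃ q, M.langFrom (q, 0) = A.lang := by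
  refine ⟨_, (RegionMachine.ofOneTA A).isStrict_strictify, (some A.init, 0), ?_⟩
  rw [RegionMachine.langFrom_strictify, Fin.val_zero, Nat.cast_zero, add_zero,
    RegionMachine.langFrom_ofOneTA hA]
  rfl

theorem IsDTARecognizable.exists_isStrict_machine_minConst (hL : IsDTARecognizable L) :
    ∃ M : RegionMachine α (minConst L), M.IsStrict ∧ ∃ q, M.langFrom (q, 0) = L := by
  obtain ⟨A, hA, hAK, rfl⟩ := Nat.sInf_mem
    (s := {K | ∃ A : OneTA α, A.IsDeterministic ∧ A.maxConst = K ∧ A.lang = L})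
    (hL.imp' OneTA.maxConst fun A h => ⟨A, h.1, rfl, h.2⟩)
  rw [minConst, ← hAK]
  exact hA.exists_isStrict_machine

end ExistsMachine

/-! ### Rigidity -/

/-- No integer shifts of `ν` and `μ` coincide. -/
def Incongruent (ν μ : ℝ≥0) : Prop := ∀ c d : ℕ, ν + c ≠ μ + d

namespace Incongruent

variable {ν μ : ℝ≥0}

theorem symm (h : Incongruent ν μ) : Incongruent μ ν := fun c d hcd => h d c hcd.symm

theorem add_right (h : Incongruent ν μ) (t : ℝ≥0) : Incongruent (ν + t) (μ + t) := by
  intro c d hcd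
  refine h c d (add_right_cancel (b := t) ?_)
  rw [add_right_comm, hcd, add_right_comm]

theorem isNonInt_or (h : Incongruent ν μ) : IsNonInt ν ∨ IsNonInt μ := by
  by_contra! hint
  simp only [IsNonInt, ne_eq, not_forall, not_not] at hint
  obtain ⟨⟨c, rfl⟩, ⟨d, rfl⟩⟩ := hint
  exact h d c (add_comm _ _)

end Incongruent

theorem IsNonInt.incongruent_zero {ν : ℝ≥0} (h : IsNonInt ν) : Incongruent ν 0 := by
  intro c d hcd
  exact isNonInt_add_natCast.2 h d (hcd.trans (zero_add _))

namespace RegionMachine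

variable {α : Type u} {K K' : ℕ}

/-- Configurations of two strict machines with the same language and incongruent clock values. At
any time at least one of the two clocks shows a nonintegral value, so that the common language
cannot detect the moment at which the other clock passes an integer. -/
structure IsTwin (M : RegionMachine α K) (c : M.State × ℝ≥0) (M' : RegionMachine α K')
    (c' : M'.State × ℝ≥0) : Prop where
  isStrict : M.IsStrict
  isStrict' : M'.IsStrict
  langFrom_eq : M.langFrom c = M'.langFrom c'
  incongruent : Incongruent c.2 c'.2

variable {M : RegionMachine α K} {M' : RegionMachine α K'} {q : M.State} {c : M.State × ℝ≥0}
  {c' : M'.State × ℝ≥0} {ν t : ℝ≥0} {a : α} {w : TimedWord α}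

theorem IsTwin.symm (h : IsTwin M c M' c') : IsTwin M' c' M c :=
  ⟨h.isStrict', h.isStrict, h.langFrom_eq.symm, h.incongruent.symm⟩

theorem IsTwin.next (h : IsTwin M c M' c') (hkeep : (M.step c.1 a (c.2 + t)).2 = true) :
    IsTwin M ((M.step c.1 a (c.2 + t)).1, c.2 + t) M' (M'.next c' (t, a)) where
  isStrict := h.isStrict
  isStrict' := h.isStrict'
  langFrom_eq := by
    ext w
    have hw := Set.ext_iff.1 h.langFrom_eq ((t, a) :: w)
    rwa [cons_mem_langFrom, cons_mem_langFrom, RegionMachine.next, if_pos hkeep] at hw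
  incongruent := by
    simp only [RegionMachine.next]
    split_ifs
    · exact h.incongruent.add_right t
    · exact (h.isStrict _ _ _ hkeep).2.incongruent_zero

/-- Membership of `w` in the language of a configuration with a twin does not change when the clock
value moves within its region. -/
def IsRigid (w : TimedWord α) : Prop :=
  ∀ ⦃K K'⦄ ⦃M : RegionMachine α K⦄ ⦃M' : RegionMachine α K'⦄ ⦃c c'⦄, IsTwin M c M' c' →
    ∀ ⦃ν⦄, KRegionEquiv K c.2 ν → (w ∈ M.langFrom c ↔ w ∈ M.langFrom (c.1, ν))

theorem IsRigid.cons_mem_iff (hw : IsRigid w) (h : IsTwin M c M' c') {t' : ℝ≥0}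
    (hy : KRegionEquiv K (c.2 + t) (ν + t')) :
    (t, a) :: w ∈ M.langFrom c ↔ (t', a) :: w ∈ M.langFrom (c.1, ν) := by
  rw [cons_mem_langFrom, cons_mem_langFrom, next, next, ← M.step_congr c.1 a hy]
  split_ifs with hkeep
  · exact hw (h.next hkeep) hy
  · rfl

theorem IsRigid.cons_mem_iff_cons_mem (hw : IsRigid w) (h : IsTwin M c M' c') (a : α)
    (t t' : ℝ≥0) : (t, a) :: w ∈ M.langFrom c ↔ (t', a) :: w ∈ M.langFrom c := by
  have hcont (x : ℝ≥0) : Continuous fun t => x + t := continuous_const.add continuous_id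
  have hlocal : IsLocallyConstant fun t => (t, a) :: w ∈ M.langFrom c := by
    refine (IsLocallyConstant.iff_eventually_eq _).2 fun t => ?_
    rcases (h.incongruent.add_right t).isNonInt_or with hν | hν
    · filter_upwards [(hcont c.2).continuousAt.eventually hν.eventually_regionEquiv] with s hs
      exact propext (hw.cons_mem_iff h (.inl hs)).symm
    · filter_upwards [(hcont c'.2).continuousAt.eventually hν.eventually_regionEquiv] with s hs
      rw [h.langFrom_eq]
      exact propext (hw.cons_mem_iff h.symm (.inl hs)).symm
  exact iff_of_eq <|
    hlocal.apply_eq_of_isPreconnected isPreconnected_univ (Set.mem_univ t) (Set.mem_univ t')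

theorem isRigid (w : TimedWord α) : IsRigid w := by
  induction w with
  | nil => exact fun _ _ _ _ _ _ _ _ _ => Iff.rfl
  | cons p w ih =>
      intro K K' M M' c c' h ν hν
      obtain ⟨s, hs⟩ := hν.exists_add p.1
      exact (ih.cons_mem_iff_cons_mem h p.2 p.1 s).trans (ih.cons_mem_iff h hs)

end RegionMachine

/-! ### The syntactic reset function -/

theorem IsDTARecognizable.exists_isStrict_machine {α : Type u} {L : Set (TimedWord α)}
    (hL : IsDTARecognizable L) :
    ∃ (K : ℕ) (M : RegionMachine α K), M.IsStrict ∧ ∃ q, M.langFrom (q, 0) = L :=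
  ⟨_, hL.exists_isStrict_machine_minConst⟩

namespace RegionMachine

variable {α : Type u} {K : ℕ} {M : RegionMachine α K} {q : M.State} {c : M.State × ℝ≥0}
  {y z : ℝ≥0}

theorem IsStrict.exists_isTwin (hM : M.IsStrict) (hc : IsNonInt c.2)
    (hrec : IsDTARecognizable (M.langFrom c)) :
    ∃ (K' : ℕ) (M' : RegionMachine α K') (c' : M'.State × ℝ≥0), IsTwin M c M' c' := by
  obtain ⟨K', M', hM', q', hq'⟩ := hrec.exists_isStrict_machine
  exact ⟨K', M', (q', 0), hM, hM', hq'.symm, hc.incongruent_zero⟩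

theorem IsStrict.langFrom_eq_of_isDTARecognizable (hM : M.IsStrict) (hy : IsNonInt y)
    (hrec : IsDTARecognizable (M.langFrom (q, y))) (hyz : KRegionEquiv K y z) :
    M.langFrom (q, y) = M.langFrom (q, z) := by
  obtain ⟨K', M', c', htwin⟩ := hM.exists_isTwin hy hrec
  exact Set.ext fun w => isRigid w htwin hyz

theorem IsStrict.isDTARecognizable_langFrom_congr (hM : M.IsStrict) (hyK : y ≤ K) (hy : IsNonInt y)
    (hyz : KRegionEquiv K y z) :
    IsDTARecognizable (M.langFrom (q, y)) ↔ IsDTARecognizable (M.langFrom (q, z)) := by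
  constructor
  · intro h
    rwa [← hM.langFrom_eq_of_isDTARecognizable hy h hyz]
  · intro h
    rwa [← hM.langFrom_eq_of_isDTARecognizable ((hyz.isNonInt_iff hyK).1 hy) h hyz.symm]

theorem IsStrict.langFrom_next_eq_of_isDTARecognizable (hM : M.IsStrict) (hc : IsNonInt c.2)
    (hrec : IsDTARecognizable (M.langFrom c)) (a : α) (t t' : ℝ≥0) :
    M.langFrom (M.next c (t, a)) = M.langFrom (M.next c (t', a)) := by
  obtain ⟨K', M', c', htwin⟩ := hM.exists_isTwin hc hrec
  exact Set.ext fun w => (isRigid w).cons_mem_iff_cons_mem htwin a t t'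

theorem IsStrict.next_eq_of_gt (hM : M.IsStrict) {p : ℝ≥0 × α} (h : K < c.2 + p.1) :
    M.next c p = ((M.step c.1 p.2 (K + 1)).1, 0) := by
  rw [next, if_neg fun hkeep => (hM _ _ _ hkeep).1.not_gt h,
    M.step_congr c.1 p.2 (.of_gt h (lt_add_one (K : ℝ≥0)))]

/-- The clock is reset as soon as the residual language is recognizable. -/
def IsEager (M : RegionMachine α K) : Prop :=
  ∀ q a y, (M.step q a y).2 = true → ¬ IsDTARecognizable (M.langFrom ((M.step q a y).1, y))

open Classical in
/-- The machine that resets its clock as soon as the residual language is recognizable. The flag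
records such a reset; by rigidity the delay before the next letter is then irrelevant, so that
letter can be read at clock value `K + 1`. -/
noncomputable abbrev eager (M : RegionMachine α K) (hM : M.IsStrict) : RegionMachine α K where
  State := M.State × Bool
  finite_State := have := M.finite_State; inferInstance
  step x a y :=
    if x.2 then (((M.step x.1 a (K + 1)).1, false), false)
    else
      let m := M.step x.1 a y
      let recognizable := decide (IsDTARecognizable (M.langFrom (m.1, y)))
      ((m.1, m.2 && recognizable), m.2 && !recognizable)
  final := {x | x.1 ∈ M.final}
  step_congr := by
    rintro ⟨q, _ | _⟩ a y z h
    · have hstep := M.step_congr q a h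
      cases hkeep : (M.step q a z).2
      · simp [hstep, hkeep]
      · rw [← hstep] at hkeep
        obtain ⟨hyK, hy⟩ := hM _ _ _ hkeep
        simp [← hstep, hM.isDTARecognizable_langFrom_congr hyK hy h]
    · rfl

theorem isStrict_eager (hM : M.IsStrict) : (M.eager hM).IsStrict := by
  rintro ⟨q, _ | _⟩ a y h
  · simp only [Bool.false_eq_true, if_false, Bool.and_eq_true] at h
    exact hM _ _ _ h.1
  · simp at h

theorem next_eager_true (hM : M.IsStrict) (hy : IsNonInt y)
    (hrec : IsDTARecognizable (M.langFrom (q, y))) (ν : ℝ≥0) (p : ℝ≥0 × α) :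
    ∃ q', (M.eager hM).next ((q, true), ν) p = ((q', false), 0) ∧
      M.langFrom (M.next (q, y) p) = M.langFrom (q', 0) := by
  refine ⟨(M.step q p.2 (K + 1)).1, by simp [next], ?_⟩
  have hlate : (K : ℝ≥0) < y + (K + 1) := (lt_add_one _).trans_le le_add_self
  rw [hM.langFrom_next_eq_of_isDTARecognizable (c := (q, y)) hy hrec p.2 p.1 (K + 1),
    hM.next_eq_of_gt (c := (q, y)) hlate]

theorem next_eager_false (hM : M.IsStrict) (q : M.State) (ν : ℝ≥0) (p : ℝ≥0 × α) :
    (∃ q', IsNonInt (ν + p.1) ∧ IsDTARecognizable (M.langFrom (q', ν + p.1)) ∧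
      (M.eager hM).next ((q, false), ν) p = ((q', true), 0) ∧ M.next (q, ν) p = (q', ν + p.1)) ∨
    ∃ q' ν', (M.eager hM).next ((q, false), ν) p = ((q', false), ν') ∧
      M.next (q, ν) p = (q', ν') := by
  cases hkeep : (M.step q p.2 (ν + p.1)).2
  · exact .inr ⟨(M.step q p.2 (ν + p.1)).1, 0, by simp [next, hkeep], by simp [next, hkeep]⟩
  · by_cases hrec : IsDTARecognizable (M.langFrom ((M.step q p.2 (ν + p.1)).1, ν + p.1))
    · exact .inl ⟨_, (hM _ _ _ hkeep).2, hrec, by simp [next, hkeep, hrec], by simp [next, hkeep]⟩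
    · exact .inr ⟨(M.step q p.2 (ν + p.1)).1, ν + p.1,
        by simp [next, hkeep, hrec], by simp [next, hkeep]⟩

theorem langFrom_eager (hM : M.IsStrict) (q : M.State) (ν : ℝ≥0) :
    (M.eager hM).langFrom ((q, false), ν) = M.langFrom (q, ν) := by
  suffices h : ∀ w q, (∀ ν, w ∈ (M.eager hM).langFrom ((q, false), ν) ↔ w ∈ M.langFrom (q, ν)) ∧
      ∀ y ν, IsNonInt y → IsDTARecognizable (M.langFrom (q, y)) →
        (w ∈ (M.eager hM).langFrom ((q, true), ν) ↔ w ∈ M.langFrom (q, y)) from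
    Set.ext fun w => (h w q).1 ν
  intro w
  induction w with
  | nil => exact fun _ => ⟨fun _ => Iff.rfl, fun _ _ _ _ => Iff.rfl⟩
  | cons p w ih =>
      refine fun q => ⟨fun ν => ?_, fun y ν hy hrec => ?_⟩
      · rw [cons_mem_langFrom, cons_mem_langFrom]
        obtain ⟨q', hy, hrec, he, hm⟩ | ⟨q', ν', he, hm⟩ := next_eager_false hM q ν p
        · rw [he, hm]
          exact (ih q').2 _ 0 hy hrec
        · rw [he, hm]
          exact (ih q').1 ν'
      · obtain ⟨q', he, hm⟩ := next_eager_true hM hy hrec ν p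
        rw [cons_mem_langFrom, cons_mem_langFrom, he, hm]
        exact (ih q').1 0

theorem isEager_eager (hM : M.IsStrict) : (M.eager hM).IsEager := by
  rintro ⟨q, _ | _⟩ a y h
  · simp only [Bool.false_eq_true, if_false, Bool.and_eq_true, Bool.not_eq_true',
      decide_eq_false_iff_not] at h
    obtain ⟨hkeep, hrec⟩ := h
    simpa only [hkeep, hrec, Bool.false_eq_true, if_false, decide_false, Bool.and_false,
      langFrom_eager hM] using hrec
  · simp at h

end RegionMachine

theorem residualLang_append {α : Type u} (L : Set (TimedWord α)) (u v : TimedWord α) :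
    residualLang L (u ++ v) = residualLang (residualLang L u) v := by
  ext w
  simp only [residualLang, Set.mem_ofPred_eq, List.append_assoc]

theorem nil_mem_residualLang {α : Type u} {L : Set (TimedWord α)} {u : TimedWord α} :
    [] ∈ residualLang L u ↔ u ∈ L := by
  simp only [residualLang, Set.mem_ofPred_eq, List.append_nil]

theorem isResetFunction_synReset {α : Type u} (L : Set (TimedWord α)) :
    IsResetFunction (synReset L) where
  nil := synReset_nil L
  snoc u t a := by
    rw [synReset_snoc]
    split_ifs
    · exact .inl rfl
    · exact .inr rfl

theorem synReset_append_congr {α : Type u} {L : Set (TimedWord α)} {u v : TimedWord α}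
    (h : synReset L u = synReset L v) (h' : residualLang L u = residualLang L v)
    (w : TimedWord α) : synReset L (u ++ w) = synReset L (v ++ w) := by
  induction w using List.reverseRecOn with
  | nil => simpa only [List.append_nil] using h
  | append_singleton w p ih =>
      rw [← List.append_assoc, ← List.append_assoc, synReset_snoc, synReset_snoc, ih,
        List.append_assoc u, List.append_assoc v, residualLang_append, h', ← residualLang_append]

section NormalForm

variable {α : Type u}

theorem normalFormAux_snoc (R : TimedWord α → ℝ≥0) (pre w : TimedWord α) (t : ℝ≥0) (a : α) :
    normalFormAux R pre (w ++ [(t, a)]) =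
      normalFormAux R pre w ++ [(hi (R (pre ++ w) + t) - hi (R (pre ++ w)), a)] := by
  induction w generalizing pre with
  | nil => simp only [normalFormAux, List.nil_append, List.append_nil]
  | cons p w ih => simp only [normalFormAux, ih, List.cons_append, List.append_assoc,
      List.nil_append]

theorem normalForm_snoc (R : TimedWord α → ℝ≥0) (w : TimedWord α) (t : ℝ≥0) (a : α) :
    normalForm R (w ++ [(t, a)]) = normalForm R w ++ [(hi (R w + t) - hi (R w), a)] :=
  normalFormAux_snoc R [] w t a

theorem isHIWord_nil : IsHIWord ([] : TimedWord α) := List.forall_mem_nil _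

theorem isHIWord_append {u v : TimedWord α} : IsHIWord (u ++ v) ↔ IsHIWord u ∧ IsHIWord v :=
  List.forall_mem_append

theorem isHIWord_cons {p : ℝ≥0 × α} {v : TimedWord α} :
    IsHIWord (p :: v) ↔ IsHalfInt p.1 ∧ IsHIWord v :=
  List.forall_mem_cons

theorem isHIWord_singleton {p : ℝ≥0 × α} : IsHIWord [p] ↔ IsHalfInt p.1 :=
  List.forall_mem_singleton

theorem isHIWord_normalFormAux (R : TimedWord α → ℝ≥0) (pre w : TimedWord α) :
    IsHIWord (normalFormAux R pre w) := by
  induction w generalizing pre with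
  | nil => exact isHIWord_nil
  | cons p w ih => exact isHIWord_cons.2 ⟨(isHalfInt_hi _).tsub (isHalfInt_hi _), ih _⟩

theorem IsResetFunction.isHalfInt {R : TimedWord α → ℝ≥0} (hR : IsResetFunction R)
    {w : TimedWord α} (hw : IsHIWord w) : IsHalfInt (R w) := by
  induction w using List.reverseRecOn with
  | nil => exact hR.nil ▸ isHalfInt_zero
  | append_singleton w p ih =>
      rw [isHIWord_append, isHIWord_singleton] at hw
      obtain h | h := hR.snoc w p.1 p.2
      · exact h ▸ isHalfInt_zero
      · exact h ▸ (ih hw.1).add hw.2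

end NormalForm

namespace RegionMachine

variable {α : Type u} {K : ℕ} {M : RegionMachine α K} {c : M.State × ℝ≥0}

theorem IsStrict.run_snd_eq_zero_or (hM : M.IsStrict) (q : M.State) (u : TimedWord α) :
    (M.run (q, 0) u).2 = 0 ∨ (M.run (q, 0) u).2 ≤ K ∧ IsNonInt (M.run (q, 0) u).2 := by
  induction u using List.reverseRecOn with
  | nil => exact .inl rfl
  | append_singleton u p _ =>
      rw [run_snoc, next]
      split_ifs with hkeep
      · exact .inr (hM _ _ _ hkeep)
      · exact .inl rfl

theorem IsEager.run_snd_eq_synReset [Finite α] (hM : M.IsEager) (q : M.State) (u : TimedWord α) :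
    (M.run (q, 0) u).2 = synReset (M.langFrom (q, 0)) u := by
  induction u using List.reverseRecOn with
  | nil => rfl
  | append_singleton u p ih =>
      rw [synReset_snoc, residualLang_langFrom, run_snoc, ← ih]
      cases hkeep : (M.step (M.run (q, 0) u).1 p.2 ((M.run (q, 0) u).2 + p.1)).2
      · have hnext : M.next (M.run (q, 0) u) p = ((M.next (M.run (q, 0) u) p).1, 0) := by
          simp only [next, hkeep, Bool.false_eq_true, if_false]
        rw [hnext, if_pos (M.isDTARecognizable_langFrom _)]
      · have hnext : M.next (M.run (q, 0) u) p =
            ((M.step (M.run (q, 0) u).1 p.2 ((M.run (q, 0) u).2 + p.1)).1,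
              (M.run (q, 0) u).2 + p.1) := by
          simp only [next, hkeep, if_true]
        rw [hnext, if_neg (hM _ _ _ hkeep)]

theorem run_normalForm {R : TimedWord α → ℝ≥0} (hR : ∀ u, (M.run c u).2 = R u)
    (hc : c.2 = 0) (u : TimedWord α) :
    M.run c (normalForm R u) = ((M.run c u).1, hi (R u)) := by
  induction u using List.reverseRecOn with
  | nil =>
      rw [← hR []]
      exact Prod.ext rfl (hc.trans (hi_eq_zero_iff.2 hc).symm)
  | append_singleton u p ih =>
      have hclock : hi (R u) + (hi (R u + p.1) - hi (R u)) = hi (R u + p.1) :=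
        add_tsub_cancel_of_le (hi_mono le_self_add)
      rw [normalForm_snoc, ← hR (u ++ [p]), run_snoc, run_snoc, ih]
      simp only [next, hclock, hR u, ← M.step_congr _ p.2 (kRegionEquiv_hi K (R u + p.1))]
      split_ifs
      · rfl
      · rw [(hi_eq_zero_iff.2 rfl)]

end RegionMachine

namespace IsDTARecognizable

variable {α : Type u} [Finite α] {L : Set (TimedWord α)}

theorem exists_machine_run_snd_eq_synReset (hL : IsDTARecognizable L) :
    ∃ M : RegionMachine α (minConst L), M.IsStrict ∧ ∃ q,
      (∀ u, residualLang L u = M.langFrom (M.run (q, 0) u)) ∧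
      ∀ u, (M.run (q, 0) u).2 = synReset L u := by
  obtain ⟨M, hM, q, hq⟩ := hL.exists_isStrict_machine_minConst
  have hlang : (M.eager hM).langFrom ((q, false), 0) = L := (M.langFrom_eager hM q 0).trans hq
  refine ⟨M.eager hM, M.isStrict_eager hM, (q, false), fun u => ?_, fun u => ?_⟩
  · rw [← RegionMachine.residualLang_langFrom, hlang]
  · rw [(M.isEager_eager hM).run_snd_eq_synReset, hlang]

variable {u : TimedWord α} {t t' : ℝ≥0} {a : α}

theorem synReset_eq_zero_or (hL : IsDTARecognizable L) (u : TimedWord α) :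
    synReset L u = 0 ∨ synReset L u ≤ minConst L ∧ IsNonInt (synReset L u) := by
  obtain ⟨M, hM, q, -, hrun⟩ := hL.exists_machine_run_snd_eq_synReset
  exact hrun u ▸ hM.run_snd_eq_zero_or q u

theorem isStrictResetFunction_synReset (hL : IsDTARecognizable L) :
    IsStrictResetFunction (synReset L) where
  toIsResetFunction := isResetFunction_synReset L
  not_posInt u := not_isPosInt_iff.2 <| (hL.synReset_eq_zero_or u).imp_right And.right

theorem synReset_le_minConst (hL : IsDTARecognizable L) (u : TimedWord α) :
    synReset L u ≤ minConst L :=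
  (hL.synReset_eq_zero_or u).elim (fun h => h ▸ zero_le) And.left

theorem residualLang_snoc_of_minConst_lt (hL : IsDTARecognizable L)
    (h : minConst L < synReset L u + t) (h' : minConst L < synReset L u + t') :
    residualLang L (u ++ [(t, a)]) = residualLang L (u ++ [(t', a)]) := by
  obtain ⟨M, hM, q, hres, hrun⟩ := hL.exists_machine_run_snd_eq_synReset
  rw [← hrun] at h h'
  rw [hres, hres, M.run_snoc, M.run_snoc,
    hM.next_eq_of_gt (p := (t, a)) h, hM.next_eq_of_gt (p := (t', a)) h']

theorem synReset_snoc_of_minConst_lt (hL : IsDTARecognizable L)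
    (h : minConst L < synReset L u + t) : synReset L (u ++ [(t, a)]) = 0 :=
  ((isResetFunction_synReset L).snoc u t a).resolve_right fun h' =>
    (h' ▸ hL.synReset_le_minConst (u ++ [(t, a)])).not_gt h

theorem synReset_normalForm (hL : IsDTARecognizable L) (u : TimedWord α) :
    synReset L (normalForm (synReset L) u) = hi (synReset L u) := by
  obtain ⟨M, -, q, -, hrun⟩ := hL.exists_machine_run_snd_eq_synReset
  rw [← hrun, M.run_normalForm hrun rfl]

theorem normalForm_mem_iff (hL : IsDTARecognizable L) (u : TimedWord α) :
    normalForm (synReset L) u ∈ L ↔ u ∈ L := by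
  obtain ⟨M, -, q, hres, hrun⟩ := hL.exists_machine_run_snd_eq_synReset
  rw [← nil_mem_residualLang, ← nil_mem_residualLang (u := u), hres, hres,
    M.run_normalForm hrun rfl]
  rfl

theorem finite_synSetoid (hL : IsDTARecognizable L) : Finite (Quotient (synSetoid L)) := by
  obtain ⟨M, -, q, hres, hrun⟩ := hL.exists_machine_run_snd_eq_synReset
  have := M.finite_State
  let f (u : {u : TimedWord α // IsHIWord u}) : M.State × Fin (2 * minConst L + 2) :=
    ((M.run (q, 0) u).1, ⟨regionIndex (minConst L) (synReset L u), regionIndex_lt _ _⟩)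
  refine .of_injective (fun x => f x.out) fun x y hxy => Quotient.out_equiv_out.1 ?_
  obtain ⟨hstate, hindex⟩ := Prod.ext_iff.1 hxy
  have hreset : synReset L x.out = synReset L y.out :=
    ((isResetFunction_synReset L).isHalfInt x.out.2).eq_of_kRegionEquiv
      ((isResetFunction_synReset L).isHalfInt y.out.2)
      (kRegionEquiv_iff_regionIndex.2 (Fin.ext_iff.1 hindex)) (hL.synReset_le_minConst _)
  refine ⟨hreset, ?_⟩
  rw [hres, hres]
  exact congrArg _ (Prod.ext hstate ((hrun _).trans (hreset.trans (hrun _).symm)))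

end IsDTARecognizable

namespace OneTA

variable {α : Type u} {A : OneTA α} {q q₁ q₂ : A.Q} {ν ν₁ ν₂ t : ℝ≥0} {w : TimedWord α}
  {θs θs₁ θs₂ : List (ClockTransition α A.Q)}

theorem IsDeterministic.run_unique (hA : A.IsDeterministic) (h₁ : A.Run q ν w θs₁ q₁ ν₁)
    (h₂ : A.Run q ν w θs₂ q₂ ν₂) : θs₁ = θs₂ ∧ q₁ = q₂ ∧ ν₁ = ν₂ := by
  induction w generalizing q ν θs₁ θs₂ with
  | nil =>
      obtain ⟨rfl, rfl, rfl⟩ := run_nil_iff.1 h₁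
      obtain ⟨rfl, rfl, rfl⟩ := run_nil_iff.1 h₂
      exact ⟨rfl, rfl, rfl⟩
  | cons p w ih =>
      obtain ⟨θ₁, θs₁, rfl, hθ₁, h₁⟩ := run_cons_iff.1 h₁
      obtain ⟨θ₂, θs₂, rfl, hθ₂, h₂⟩ := run_cons_iff.1 h₂
      obtain rfl := hA.enabled_unique hθ₁ hθ₂
      obtain ⟨rfl, rfl, rfl⟩ := ih h₁ h₂
      exact ⟨rfl, rfl, rfl⟩

theorem IsDeterministic.mem_lang_iff (hA : A.IsDeterministic)
    (hrun : A.Run A.init 0 w θs q ν) : w ∈ A.lang ↔ q ∈ A.final := by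
  refine ⟨?_, fun hq => ⟨θs, q, ν, hrun, hq⟩⟩
  rintro ⟨θs', q', ν', hrun', hq'⟩
  obtain ⟨-, rfl, -⟩ := hA.run_unique hrun hrun'
  exact hq'

theorem Run.snoc {q' : A.Q} {ν' : ℝ≥0} (hrun : A.Run q ν w θs q' ν')
    {θ : ClockTransition α A.Q} {a : α} (hθ : A.Enabled q' a (ν' + t) θ) :
    A.Run q ν (w ++ [(t, a)]) (θs ++ [θ]) θ.tgt (if θ.keep then ν' + t else 0) := by
  induction hrun with
  | nil q ν =>
      obtain ⟨hmem, rfl, rfl, hguard⟩ := hθ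
      exact .cons θ ν t [] [] _ _ hmem hguard (.nil _ _)
  | cons θ' ν s w θs q' ν' hθ' hguard' _ ih => exact .cons θ' ν s _ _ _ _ hθ' hguard' (ih hθ)

end OneTA

/-! ### The conjecture of a table -/

theorem snoc_mem_extensions {α : Type u} {K : ℕ} {S : Set (TimedWord α)} {s : TimedWord α}
    {p : ℝ≥0 × α} (hs : s ∈ S) (hp : p ∈ sigmaK α K) : s ++ [p] ∈ extensions K S :=
  ⟨s, hs, p, hp, rfl⟩

namespace ObsTable

variable {α : Type u} {T : ObsTable α} {L : Set (TimedWord α)} {s s' : TimedWord α}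
  {p : ℝ≥0 × α} {t t' : ℝ≥0} {a : α}

theorem row_eq_iff : T.row s = T.row s' ↔ ∀ e ∈ T.E, T.entry s e = T.entry s' e :=
  ⟨fun h e he => congrFun h ⟨e, he⟩, fun h => funext fun e => h e.1 e.2⟩

theorem r_eq_of_row_eq (h : T.row s = T.row s') : T.r s = T.r s' :=
  congrArg Prod.snd (row_eq_iff.1 h [] T.nil_mem_E)

theorem mem_cells_nil (hs : s ∈ T.S ∪ extensions T.K T.S) : (s, []) ∈ cells T.K T.S T.E :=
  ⟨hs, T.nil_mem_E⟩

theorem isHalfInt_r (hs : s ∈ T.S) : IsHalfInt (T.r s) :=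
  (T.range_entry s [] (mem_cells_nil (.inl hs))).1

theorem Filled.r_nil (hF : T.Filled L) : T.r [] = 0 := by
  obtain ⟨-, R, hR, hRT⟩ := hF
  exact (hRT _ _ (mem_cells_nil (.inl T.nil_mem_S))).trans hR.nil

theorem Filled.r_snoc (hF : T.Filled L) (hs : s ∈ T.S) (hp : p ∈ sigmaK α T.K) :
    T.r (s ++ [p]) = 0 ∨ T.r (s ++ [p]) = T.r s + p.1 := by
  obtain ⟨-, R, hR, hRT⟩ := hF
  rw [r, r, hRT _ _ (mem_cells_nil (.inl hs)),
    hRT _ _ (mem_cells_nil (.inr (snoc_mem_extensions hs hp))), List.append_nil, List.append_nil]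
  exact hR.snoc _ _ _

namespace Ready

theorem closed (h : T.Ready) : T.Closed := h.1

theorem consistentA (h : T.Ready) : T.ConsistentA := h.2.1

theorem consistentB (h : T.Ready) : T.ConsistentB := h.2.2.1

theorem r_le (h : T.Ready) (hs : s ∈ T.S) : T.r s ≤ T.K :=
  h.2.2.2 s [] (mem_cells_nil (.inl hs))

theorem row_snoc_eq (h : T.Ready) (hs : s ∈ T.S) (hs' : s' ∈ T.S) (hrow : T.row s = T.row s')
    (ht : (t, a) ∈ sigmaK α T.K) (ht' : (t', a) ∈ sigmaK α T.K)
    (hequiv : KRegionEquiv T.K (T.r s + t) (T.r s' + t')) :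
    T.row (s ++ [(t, a)]) = T.row (s' ++ [(t', a)]) := by
  by_cases hK : T.r s + t ≤ T.K
  · have hclock := ((isHalfInt_r hs).add ht.1).eq_of_kRegionEquiv ((isHalfInt_r hs').add ht'.1)
      hequiv hK
    rw [r_eq_of_row_eq hrow] at hclock
    obtain rfl := add_left_cancel hclock
    exact h.consistentA s hs s' hs' hrow _ ht
  · have hK' : T.K < T.r s' + t' := not_le.1 fun hle => hK (hequiv.le_iff.2 hle)
    rw [h.consistentB s t a (.inr (snoc_mem_extensions hs ht)) (not_le.1 hK),
      h.consistentB s' t' a (.inr (snoc_mem_extensions hs' ht')) hK']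
    exact h.consistentA s hs s' hs' hrow _ (natCast_add_half_mem_sigmaK _ _)

theorem exists_mem_sigmaK (h : T.Ready) (hs : s ∈ T.S) {ν : ℝ≥0}
    (hν : KRegionEquiv T.K (T.r s) ν) (t : ℝ≥0) (a : α) :
    ∃ t', (t', a) ∈ sigmaK α T.K ∧ KRegionEquiv T.K (T.r s + t') (ν + t) := by
  by_cases hK : ν + t ≤ T.K
  · have hr : T.r s = hi ν := (isHalfInt_r hs).eq_of_kRegionEquiv (isHalfInt_hi ν)
      (hν.trans (kRegionEquiv_hi T.K ν)) (h.r_le hs)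
    have hle : hi (ν + t) ≤ T.K := (hi_mono hK).trans (isHalfInt_natCast T.K).hi_eq.le
    refine ⟨hi (ν + t) - T.r s, IsHalfInt.mem_sigmaK_of_le
      ((isHalfInt_hi _).tsub (isHalfInt_r hs)) (tsub_le_self.trans hle) a, ?_⟩
    rw [add_tsub_cancel_of_le (hr ▸ hi_mono le_self_add)]
    exact (kRegionEquiv_hi T.K _).symm
  · refine ⟨_, natCast_add_half_mem_sigmaK T.K a, .of_gt ?_ (not_le.1 hK)⟩
    calc (T.K : ℝ≥0) < T.K + 1 / 2 := lt_add_of_pos_right _ (by norm_num)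
      _ ≤ T.r s + (T.K + 1 / 2) := le_add_self

end Ready

section Conj

variable [Finite α] {w : TimedWord α} {q q' : T.conj.Q} {ν ν' : ℝ≥0}
  {θ : ClockTransition α T.conj.Q} {θs : List (ClockTransition α T.conj.Q)}

/-- The state `row(s)` of the conjecture. -/
def state (T : ObsTable α) (s : T.S) : T.conj.Q := ⟨T.row s, Set.mem_image_of_mem _ s.2⟩

/-- The clock value `r(s)` recorded in a state `row(s)` of the conjecture. -/
def clock (T : ObsTable α) (q : T.conj.Q) : ℝ≥0 := (q.1 ⟨[], T.nil_mem_E⟩).2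

open Classical in
/-- The transition of the conjecture from `row(s)` to `row(s')` that is read off the cell
`s p`. -/
noncomputable def transition (T : ObsTable α) (s s' : T.S) (p : ℝ≥0 × α) :
    ClockTransition α T.conj.Q where
  src := T.state s
  tgt := T.state s'
  letter := p.2
  guard := regionGuard T.K (T.r s + p.1)
  keep := !decide (T.r s' = 0)

theorem exists_state_eq (q : T.conj.Q) : ∃ s, T.state s = q := by
  obtain ⟨_, s, hs, rfl⟩ := q
  exact ⟨⟨s, hs⟩, rfl⟩

theorem state_eq_state_iff {s s' : T.S} : T.state s = T.state s' ↔ T.row s = T.row s' :=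
  Subtype.ext_iff

theorem mem_trans_conj_iff : θ ∈ T.conj.trans ↔
    ∃ (s s' : T.S) (p : ℝ≥0 × α), p ∈ sigmaK α T.K ∧ T.row (s ++ [p]) = T.row s' ∧
      θ = T.transition s s' p := by
  constructor
  · obtain ⟨⟨_, _⟩, ⟨_, _⟩, a, g, k⟩ := θ
    rintro ⟨s, hs, s', hs', p, hp, hrow, rfl, rfl, rfl, rfl, rfl⟩
    exact ⟨⟨s, hs⟩, ⟨s', hs'⟩, p, hp, hrow, rfl⟩
  · rintro ⟨s, s', p, hp, hrow, rfl⟩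
    exact ⟨s, s.2, s', s'.2, p, hp, hrow, rfl, rfl, rfl, rfl, rfl⟩

theorem keep_eq_false_iff (hθ : θ ∈ T.conj.trans) : θ.keep = false ↔ T.clock θ.tgt = 0 := by
  obtain ⟨s, s', p, -, -, rfl⟩ := mem_trans_conj_iff.1 hθ
  exact (Bool.not_eq_eq_eq_not ..).trans decide_eq_true_iff

theorem exists_denote_guard_eq (hθ : θ ∈ T.conj.trans) :
    ∃ y, θ.guard.denote = {z | KRegionEquiv T.K y z} := by
  obtain ⟨s, s', p, -, -, rfl⟩ := mem_trans_conj_iff.1 hθ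
  exact ⟨_, denote_regionGuard _ _⟩

theorem not_isPosInt_clock (q : T.conj.Q) : ¬ IsPosInt (T.clock q) := by
  obtain ⟨s, rfl⟩ := exists_state_eq q
  exact (T.range_entry s [] (mem_cells_nil (.inl s.2))).2

namespace Filled

theorem denote_guard_eq (hF : T.Filled L) (hθ : θ ∈ T.conj.trans) (hkeep : θ.keep = true) :
    θ.guard.denote = {z | KRegionEquiv T.K (T.clock θ.tgt) z} := by
  have hclock : T.clock θ.tgt ≠ 0 := fun h =>
    Bool.false_ne_true (((keep_eq_false_iff hθ).2 h).symm.trans hkeep)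
  obtain ⟨s, s', p, hp, hrow, rfl⟩ := mem_trans_conj_iff.1 hθ
  have hr : T.r (s ++ [p]) = T.r s' := r_eq_of_row_eq hrow
  have hsnoc := (hF.r_snoc s.2 hp).resolve_left fun h => hclock (hr.symm.trans h)
  exact (denote_regionGuard _ _).trans (by rw [← hsnoc, hr]; rfl)

theorem kRegionEquiv_clock_tgt (hF : T.Filled L) (hθ : θ ∈ T.conj.trans)
    (hν : ν ∈ θ.guard.denote) : KRegionEquiv T.K (T.clock θ.tgt) (if θ.keep then ν else 0) := by
  split_ifs with hkeep
  · rwa [hF.denote_guard_eq hθ hkeep] at hν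
  · rw [(keep_eq_false_iff hθ).1 (Bool.not_eq_true _ ▸ hkeep)]
    exact .refl T.K 0

theorem kRegionEquiv_clock_of_run (hF : T.Filled L) (hrun : T.conj.Run q ν w θs q' ν')
    (hν : KRegionEquiv T.K (T.clock q) ν) : KRegionEquiv T.K (T.clock q') ν' := by
  induction hrun with
  | nil => exact hν
  | cons _ _ _ _ _ _ _ hθ hguard _ ih => exact ih (hF.kRegionEquiv_clock_tgt hθ hguard)

theorem kRegionEquiv_clock (hF : T.Filled L) (hrun : T.conj.Run T.conj.init 0 w θs q ν) :
    KRegionEquiv T.K (T.clock q) ν :=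
  hF.kRegionEquiv_clock_of_run hrun (hF.r_nil ▸ .refl T.K _)

end Filled

theorem Ready.isDeterministic_conj (h : T.Ready) : T.conj.IsDeterministic := by
  intro θ hθ θ₁ hθ₁ hne
  obtain ⟨s, s', ⟨t, a⟩, hp, hrow, rfl⟩ := mem_trans_conj_iff.1 hθ
  obtain ⟨s₁, s₁', ⟨t₁, a₁⟩, hp₁, hrow₁, rfl⟩ := mem_trans_conj_iff.1 hθ₁
  by_contra! hcon
  obtain ⟨hsrc, rfl, hguard⟩ := hcon
  obtain ⟨z, hz, hz₁⟩ := Set.not_disjoint_iff.1 hguard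
  have hequiv := (mem_regionGuard.1 hz).trans (mem_regionGuard.1 hz₁).symm
  have htgt : T.row s' = T.row s₁' := hrow.symm.trans <|
    (h.row_snoc_eq s.2 s₁.2 (state_eq_state_iff.1 hsrc) hp hp₁ hequiv).trans hrow₁
  refine hne ?_
  simp only [transition] at hsrc ⊢
  simp only [hsrc, hequiv.regionGuard_eq, state_eq_state_iff.2 htgt, r_eq_of_row_eq htgt]

open Classical in
theorem exists_run_conj_snoc {s s' : T.S} (hrun : T.conj.Run q ν w θs (T.state s) ν')
    (ht' : (t', a) ∈ sigmaK α T.K) (hrow : T.row (s ++ [(t', a)]) = T.row s')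
    (hequiv : KRegionEquiv T.K (T.r s + t') (ν' + t)) :
    ∃ θs', T.conj.Run q ν (w ++ [(t, a)]) θs' (T.state s') (if T.r s' = 0 then 0 else ν' + t) := by
  have hsnoc := hrun.snoc (θ := T.transition s s' (t', a)) (t := t) (a := a)
    ⟨mem_trans_conj_iff.2 ⟨s, s', _, ht', hrow, rfl⟩, rfl, rfl, mem_regionGuard.2 hequiv⟩
  have hkeep : (T.transition s s' (t', a)).keep = true ↔ ¬ T.r s' = 0 := by
    simp only [transition, Bool.not_eq_true', decide_eq_false_iff_not]
  rw [if_congr hkeep rfl rfl, ite_not] at hsnoc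
  exact ⟨_, hsnoc⟩

namespace Ready

theorem exists_run_conj (h : T.Ready) (hF : T.Filled L) (w : TimedWord α) :
    ∃ θs q ν, T.conj.Run T.conj.init 0 w θs q ν := by
  induction w using List.reverseRecOn with
  | nil => exact ⟨_, _, _, .nil _ _⟩
  | append_singleton w p ih =>
      obtain ⟨θs, q, ν, hrun⟩ := ih
      obtain ⟨s, rfl⟩ := exists_state_eq q
      obtain ⟨t', ht', hequiv⟩ := h.exists_mem_sigmaK s.2 (hF.kRegionEquiv_clock hrun) p.1 p.2
      obtain ⟨s', hs', hrow⟩ := h.closed _ (snoc_mem_extensions s.2 ht')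
      obtain ⟨θs', hrun'⟩ := exists_run_conj_snoc (s' := ⟨s', hs'⟩) hrun ht' hrow hequiv
      exact ⟨θs', _, _, hrun'⟩

theorem isComplete_conj (h : T.Ready) (hF : T.Filled L) : T.conj.IsComplete := fun w => by
  obtain ⟨θs, q, ν, hrun⟩ := h.exists_run_conj hF w
  exact ⟨θs, ⟨q, ν, hrun⟩, fun θs' ⟨q', ν', hrun'⟩ =>
    (h.isDeterministic_conj.run_unique hrun' hrun).1⟩

theorem maxConst_conj [Nonempty α] (h : T.Ready) (hF : T.Filled L) : T.conj.maxConst = T.K := by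
  obtain ⟨a⟩ := ‹Nonempty α›
  have hp := natCast_add_half_mem_sigmaK T.K a
  obtain ⟨s', hs', hrow⟩ := h.closed _ (snoc_mem_extensions T.nil_mem_S hp)
  have hθ := mem_trans_conj_iff.2 ⟨⟨[], T.nil_mem_S⟩, ⟨s', hs'⟩, _, hp, hrow, rfl⟩
  have hgt : ¬ T.r [] + ((T.K : ℝ≥0) + 1 / 2) ≤ T.K := by
    rw [hF.r_nil, zero_add, not_le]
    exact lt_add_of_pos_right _ (by norm_num)
  refine le_antisymm (csSup_le ⟨_, Set.mem_image_of_mem _ hθ⟩ ?_) ?_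
  · rintro _ ⟨θ, hθ, rfl⟩
    obtain ⟨s, s', p, -, -, rfl⟩ := mem_trans_conj_iff.1 hθ
    exact maxConst_regionGuard_le _ _
  · exact (congrArg ClockConstraint.maxConst (if_neg hgt)).ge.trans (OneTA.maxConst_guard_le hθ)

theorem isAcceptor_conj [Nonempty α] (h : T.Ready) (hF : T.Filled L) :
    T.conj.IsAcceptor T.K where
  det := h.isDeterministic_conj
  complete := h.isComplete_conj hF
  maxConst_eq := h.maxConst_conj hF
  guard_region _ := exists_denote_guard_eq
  region := by
    refine ⟨fun q => {z | KRegionEquiv T.K (T.clock q) z}, fun q => ⟨_, rfl⟩,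
      fun w θs q ν => hF.kRegionEquiv_clock, ?_, ?_⟩
    · rintro q ⟨θ, hθ, rfl, hkeep⟩
      have hclock := (keep_eq_false_iff hθ).1 hkeep
      refine ⟨?_, fun θ₁ hθ₁ htgt => (keep_eq_false_iff hθ₁).2 (htgt ▸ hclock)⟩
      exact Set.ext fun z => hclock ▸ kRegionEquiv_zero_iff
    · rintro q hq θ hθ rfl
      exact hF.denote_guard_eq hθ (hq θ hθ rfl)

theorem isStrictAcceptor_conj [Nonempty α] (h : T.Ready) (hF : T.Filled L) :
    T.conj.IsStrictAcceptor T.K where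
  toIsAcceptor := h.isAcceptor_conj hF
  strict θ hθ c hc := by
    by_contra hkeep
    have hguard := hF.denote_guard_eq hθ (Bool.not_eq_false _ ▸ hkeep)
    have hclock : T.clock θ.tgt = c := by
      have hmem : T.clock θ.tgt ∈ θ.guard.denote := hguard ▸ KRegionEquiv.refl T.K _
      simpa only [hc, Set.mem_singleton_iff] using hmem
    refine not_isPosInt_clock θ.tgt ⟨c, Nat.pos_of_ne_zero ?_, hclock⟩
    rintro rfl
    exact hkeep ((keep_eq_false_iff hθ).2 (hclock.trans Nat.cast_zero))

theorem run_conj_le (h : T.Ready) (hF : T.Filled L) (hrun : T.conj.Run T.conj.init 0 w θs q ν) :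
    ν ≤ T.K ∧ ¬ IsPosInt ν := by
  have hν := hF.kRegionEquiv_clock hrun
  have hle : T.clock q ≤ T.K := by
    obtain ⟨s, rfl⟩ := exists_state_eq q
    exact h.r_le s.2
  refine ⟨hν.le_iff.1 hle, not_isPosInt_iff.2 ?_⟩
  refine (not_isPosInt_iff.1 (not_isPosInt_clock q)).imp (fun h0 => ?_) (hν.isNonInt_iff hle).1
  rwa [h0, kRegionEquiv_zero_iff] at hν

end Ready

end Conj

theorem exists_action (h : ¬ T.Ready) : ∃ K' S' E', T.Action K' S' E' := by
  simp only [Ready, not_and_or, Closed, ConsistentA, Valid, row_eq_iff] at h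
  push Not at h
  obtain ⟨w, hw, hne⟩ | ⟨s₁, hs₁, s₂, hs₂, hrow, p, hp, e, he, hne⟩ | hB | ⟨s, e, hse, hlt⟩ := h
  · exact ⟨_, _, _, .close w hw fun s hs hrow => by
      obtain ⟨e, he, hne⟩ := hne s hs
      exact hne (row_eq_iff.1 hrow e he)⟩
  · exact ⟨_, _, _, .distinguish s₁ s₂ p e hs₁ hs₂ hp he (row_eq_iff.2 hrow) hne⟩
  · exact ⟨_, _, _, .enlarge hB⟩
  · exact ⟨_, _, _, .validate s e hse hlt⟩

end ObsTable

/-! ### Prefixes of normal forms -/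

section NormalPrefixes

variable {α : Type u}

/-- The nonempty prefixes of the words obtained from a timed word by the normal form recursion,
started with the clock value `v`, over all possible reset decisions. -/
def normalPrefixes : ℝ≥0 → TimedWord α → Set (TimedWord α)
  | _, [] => ∅
  | v, (t, a) :: w => insert [(hi (v + t) - hi v, a)]
      (.cons (hi (v + t) - hi v, a) '' (normalPrefixes 0 w ∪ normalPrefixes (v + t) w))

theorem finite_normalPrefixes (v : ℝ≥0) (w : TimedWord α) : (normalPrefixes v w).Finite := by
  induction w generalizing v with
  | nil => exact Set.finite_empty
  | cons p w ih => exact (((ih _).union (ih _)).image _).insert _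

theorem ncard_normalPrefixes_add_one_le (v : ℝ≥0) (w : TimedWord α) :
    (normalPrefixes v w).ncard + 1 ≤ 2 ^ w.length := by
  induction w generalizing v with
  | nil => simp [normalPrefixes]
  | cons p w ih =>
      obtain ⟨t, a⟩ := p
      calc (normalPrefixes v ((t, a) :: w)).ncard + 1
          ≤ (normalPrefixes 0 w ∪ normalPrefixes (v + t) w).ncard + 1 + 1 := by
            refine Nat.add_le_add_right ((Set.ncard_insert_le _ _).trans ?_) 1
            exact Nat.add_le_add_right (Set.ncard_image_le
              ((finite_normalPrefixes _ _).union (finite_normalPrefixes _ _))) 1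
        _ ≤ ((normalPrefixes 0 w).ncard + 1) + ((normalPrefixes (v + t) w).ncard + 1) := by
            have := Set.ncard_union_le (normalPrefixes 0 w) (normalPrefixes (v + t) w)
            omega
        _ ≤ 2 ^ w.length + 2 ^ w.length := Nat.add_le_add (ih 0) (ih (v + t))
        _ = 2 ^ ((t, a) :: w).length := by rw [List.length_cons, pow_succ, mul_two]

theorem mem_normalPrefixes_of_prefix {R : TimedWord α → ℝ≥0} (hR : IsResetFunction R)
    {pre w v : TimedWord α} (hv : v <+: normalFormAux R pre w) :
    v = [] ∨ v ∈ normalPrefixes (R pre) w := by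
  induction w generalizing pre v with
  | nil => exact .inl (List.prefix_nil.1 hv)
  | cons p w ih =>
      obtain ⟨t, a⟩ := p
      rw [normalFormAux, List.prefix_cons_iff] at hv
      obtain rfl | ⟨z, rfl, hz⟩ := hv
      · exact .inl rfl
      refine .inr ?_
      obtain rfl | hz := ih hz
      · exact Set.mem_insert _ _
      refine Set.mem_insert_of_mem _ ⟨z, ?_, rfl⟩
      obtain h | h := hR.snoc pre t a
      · exact .inl (by rwa [h] at hz)
      · exact .inr (by rwa [h] at hz)

theorem mem_normalPrefixes_of_mem_normalForms {w v x : TimedWord α} (hx : x ∈ normalForms w)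
    (hv : v <+: x) : v = [] ∨ v ∈ normalPrefixes 0 w := by
  obtain ⟨R, hR, rfl⟩ := hx
  rw [← hR.nil]
  exact mem_normalPrefixes_of_prefix hR hv

end NormalPrefixes

/-! ### Row and column words -/

section Cells

variable {α : Type u} {K K' : ℕ} {S S' E E' : Set (TimedWord α)}

theorem extensions_mono (hK : K ≤ K') (hS : S ⊆ S') : extensions K S ⊆ extensions K' S' := by
  rintro _ ⟨s, hs, p, hp, rfl⟩
  exact ⟨s, hS hs, p, ⟨hp.1, hp.2.trans_le (by gcongr)⟩, rfl⟩

theorem cells_mono (hK : K ≤ K') (hS : S ⊆ S') (hE : E ⊆ E') : cells K S E ⊆ cells K' S' E' :=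
  Set.prod_mono (Set.union_subset_union hS (extensions_mono hK hS)) hE

theorem isHIWord_of_mem_cells (hS : ∀ s ∈ S, IsHIWord s) (hE : ∀ e ∈ E, IsHIWord e)
    {s e : TimedWord α} (h : (s, e) ∈ cells K S E) : IsHIWord (s ++ e) := by
  obtain ⟨hs | ⟨s, hs, p, hp, rfl⟩, he⟩ := h
  · exact isHIWord_append.2 ⟨hS s hs, hE e he⟩
  · exact isHIWord_append.2
      ⟨isHIWord_append.2 ⟨hS s hs, isHIWord_singleton.2 hp.1⟩, hE e he⟩

/-- The conditions that the row words `S` and the column words `E` of a table satisfy. -/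
structure IsTableShape (S E : Set (TimedWord α)) : Prop where
  finite_S : S.Finite
  finite_E : E.Finite
  nil_mem_S : [] ∈ S
  nil_mem_E : [] ∈ E
  hi_S : ∀ s ∈ S, IsHIWord s
  hi_E : ∀ e ∈ E, IsHIWord e
  prefix_S : ∀ s ∈ S, ∀ v, v <+: s → v ∈ S
  suffix_E : ∀ e ∈ E, ∀ v, v <:+ e → v ∈ E

namespace IsTableShape

theorem singleton_nil : IsTableShape ({[]} : Set (TimedWord α)) {[]} where
  finite_S := Set.finite_singleton _
  finite_E := Set.finite_singleton _
  nil_mem_S := rfl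
  nil_mem_E := rfl
  hi_S := by rintro _ rfl; exact isHIWord_nil
  hi_E := by rintro _ rfl; exact isHIWord_nil
  prefix_S := by rintro _ rfl v hv; exact List.prefix_nil.1 hv
  suffix_E := by rintro _ rfl v hv; exact List.suffix_nil.1 hv

theorem union_row (h : IsTableShape S E) {s : TimedWord α} (hs : s ∈ S) {p : ℝ≥0 × α}
    (hp : IsHalfInt p.1) : IsTableShape (S ∪ {s ++ [p]}) E where
  __ := h
  finite_S := h.finite_S.union (Set.finite_singleton _)
  nil_mem_S := .inl h.nil_mem_S
  hi_S := by
    rintro w (hw | rfl)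
    · exact h.hi_S w hw
    · exact isHIWord_append.2 ⟨h.hi_S s hs, isHIWord_singleton.2 hp⟩
  prefix_S := by
    rintro w (hw | rfl) v hv
    · exact .inl (h.prefix_S w hw v hv)
    · exact (List.prefix_concat_iff.1 hv).symm.imp (h.prefix_S s hs v) id

theorem union_column (h : IsTableShape S E) {e : TimedWord α} (he : e ∈ E) {p : ℝ≥0 × α}
    (hp : IsHalfInt p.1) : IsTableShape S (E ∪ {p :: e}) where
  __ := h
  finite_E := h.finite_E.union (Set.finite_singleton _)
  nil_mem_E := .inl h.nil_mem_E
  hi_E := by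
    rintro w (hw | rfl)
    · exact h.hi_E w hw
    · exact isHIWord_cons.2 ⟨hp, h.hi_E e he⟩
  suffix_E := by
    rintro w (hw | rfl) v hv
    · exact .inl (h.suffix_E w hw v hv)
    · exact (List.suffix_cons_iff.1 hv).symm.imp (h.suffix_E e he v) id

end IsTableShape

end Cells

namespace ObsTable

variable {α : Type u} {T : ObsTable α} {K' : ℕ} {S' E' : Set (TimedWord α)}

theorem isTableShape (T : ObsTable α) : IsTableShape T.S T.E where
  __ := T

/-- The parameters `(K', S', E')` of the tables that may replace `T` in the next pool. -/
structure IsExtendedBy (T : ObsTable α) (K' : ℕ) (S' E' : Set (TimedWord α)) : Prop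
    extends IsTableShape S' E' where
  le : T.K ≤ K'
  subset_S : T.S ⊆ S'
  subset_E : T.E ⊆ E'

theorem Action.isExtendedBy (h : T.Action K' S' E') : T.IsExtendedBy K' S' E' where
  toIsTableShape := by
    cases h with
    | close w hw =>
        obtain ⟨s, hs, p, hp, rfl⟩ := hw
        exact T.isTableShape.union_row hs hp.1
    | distinguish _ _ _ _ _ _ hp he => exact T.isTableShape.union_column he hp.1
    | _ => exact T.isTableShape
  le := by cases h <;> omega
  subset_S := by
    cases h with
    | close => exact Set.subset_union_left
    | _ => exact subset_rfl
  subset_E := by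
    cases h with
    | distinguish => exact Set.subset_union_left
    | _ => exact subset_rfl

theorem refineRows_subset (T : ObsTable α) (w : TimedWord α) :
    T.refineRows w ⊆ T.S ∪ normalPrefixes 0 w := by
  rintro v (hv | ⟨x, hx, hv⟩)
  · exact .inl hv
  · obtain rfl | h := mem_normalPrefixes_of_mem_normalForms hx hv
    · exact .inl T.nil_mem_S
    · exact .inr h

theorem isExtendedBy_refineRows (T : ObsTable α) (w : TimedWord α) :
    T.IsExtendedBy T.K (T.refineRows w) T.E where
  __ := T.isTableShape
  finite_S := (T.finite_S.union (finite_normalPrefixes 0 w)).subset (T.refineRows_subset w)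
  nil_mem_S := .inl T.nil_mem_S
  hi_S := by
    rintro v (hv | ⟨_, ⟨R, -, rfl⟩, z, hz⟩)
    · exact T.hi_S v hv
    · have hw : IsHIWord (normalForm R w) := isHIWord_normalFormAux R [] w
      exact (isHIWord_append.1 (hz ▸ hw)).1
  prefix_S := by
    rintro v (hv | ⟨x, hx, hv⟩) z hz
    · exact .inl (T.prefix_S v hv z hz)
    · exact .inr ⟨x, hx, hz.trans hv⟩
  le := le_rfl
  subset_S := Set.subset_union_left
  subset_E := subset_rfl

end ObsTable

/-! ### Tables filled with the syntactic reset function -/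

open Classical in
/-- The content of the cell of a word `w`, when the reset assignment is that of `R^L`. -/
noncomputable def synEntry {α : Type u} (L : Set (TimedWord α)) (w : TimedWord α) : Bool × ℝ≥0 :=
  (decide (w ∈ L), synReset L w)

/-- The row of a word `s` over the columns `E`, when the reset assignment is that of `R^L`. -/
noncomputable def synRow {α : Type u} (L E : Set (TimedWord α)) (s : TimedWord α) :
    E → Bool × ℝ≥0 :=
  fun e => synEntry L (s ++ e)

/-- The number of rows of the words of `S` over the columns `E`, when the reset assignment is that
of `R^L`. -/
noncomputable def rowCount {α : Type u} (L S E : Set (TimedWord α)) : ℕ :=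
  (synRow L E '' S).ncard

section RowCount

variable {α : Type u} {L S S' E E' : Set (TimedWord α)} {u v : TimedWord α}

theorem synEntry_append_congr (h : synReset L u = synReset L v)
    (h' : residualLang L u = residualLang L v) (w : TimedWord α) :
    synEntry L (u ++ w) = synEntry L (v ++ w) :=
  Prod.ext (decide_eq_decide.2 (Set.ext_iff.1 h' w)) (synReset_append_congr h h' w)

theorem rowCount_le [Finite α] (hL : IsDTARecognizable L) (hS : ∀ s ∈ S, IsHIWord s) :
    rowCount L S E ≤ synIndex L := by
  have := hL.finite_synSetoid
  let rowOfClass : Quotient (synSetoid L) → E → Bool × ℝ≥0 :=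
    Quotient.lift (fun w => synRow L E w.1)
      fun _ _ h => funext fun e => synEntry_append_congr h.1 h.2 e
  have hsub : synRow L E '' S ⊆ Set.range rowOfClass := by
    rintro _ ⟨s, hs, rfl⟩
    exact ⟨⟦⟨s, hS s hs⟩⟧, rfl⟩
  calc rowCount L S E ≤ (Set.range rowOfClass).ncard := Set.ncard_le_ncard hsub
    _ ≤ synIndex L := Finite.card_range_le _

theorem rowCount_mono_left (hS' : S'.Finite) (h : S ⊆ S') : rowCount L S E ≤ rowCount L S' E :=
  Set.ncard_le_ncard (Set.image_mono h) (hS'.image _)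

theorem rowCount_lt_right (hS : S.Finite) (h : E ⊆ E') (hu : u ∈ S) (hv : v ∈ S)
    (hE : synRow L E u = synRow L E v) (hE' : synRow L E' u ≠ synRow L E' v) :
    rowCount L S E < rowCount L S E' := by
  have himage : synRow L E '' S = (· ∘ Set.inclusion h) '' (synRow L E' '' S) :=
    (Set.image_image (· ∘ Set.inclusion h) (synRow L E') S).symm
  rw [rowCount, rowCount, himage]
  refine (Set.ncard_image_le (hS.image _)).lt_of_ne fun hcard => hE' ?_
  exact Set.injOn_of_ncard_image_eq hcard (hS.image _) ⟨u, hu, rfl⟩ ⟨v, hv, rfl⟩ hE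

end RowCount

namespace ObsTable

variable {α : Type u} {T T' : ObsTable α} {L : Set (TimedWord α)} {s : TimedWord α}
  {K' : ℕ} {S' E' : Set (TimedWord α)}

/-- The tables whose reset assignment is that of the syntactic reset function and whose constant
does not exceed `K_L`: each pool contains one of them as long as the algorithm has not halted. -/
structure IsSyntactic (L : Set (TimedWord α)) (T : ObsTable α) : Prop where
  le : T.K ≤ minConst L
  entry_eq : ∀ s e, (s, e) ∈ cells T.K T.S T.E → T.entry s e = synEntry L (s ++ e)

/-- The progress measure of a table: its constant plus its number of states. -/
noncomputable def level (T : ObsTable α) : ℕ := T.K + (T.row '' T.S).ncard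

theorem level_pos (T : ObsTable α) : 0 < T.level :=
  Nat.add_pos_right _ ((Set.ncard_pos (T.finite_S.image _)).2 ⟨_, [], T.nil_mem_S, rfl⟩)

namespace IsSyntactic

theorem row_eq (h : T.IsSyntactic L) (hs : s ∈ T.S ∪ extensions T.K T.S) :
    T.row s = synRow L T.E s :=
  funext fun e => h.entry_eq s e ⟨hs, e.2⟩

theorem r_eq (h : T.IsSyntactic L) (hs : s ∈ T.S) : T.r s = synReset L s := by
  rw [r, h.entry_eq s [] (mem_cells_nil (.inl hs)), List.append_nil, synEntry]

theorem level_eq (h : T.IsSyntactic L) : T.level = T.K + rowCount L T.S T.E := by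
  rw [level, rowCount, Set.image_congr fun s hs => h.row_eq (.inl hs)]

theorem level_le [Finite α] (h : T.IsSyntactic L) (hL : IsDTARecognizable L) :
    T.level ≤ minConst L + synIndex L :=
  h.level_eq ▸ Nat.add_le_add h.le (rowCount_le hL T.hi_S)

theorem filled (h : T.IsSyntactic L) (hR : IsStrictResetFunction (synReset L)) : T.Filled L := by
  refine ⟨fun s e hse => ?_, synReset L, hR, fun s e hse => ?_⟩
  · rw [h.entry_eq s e hse]
    simp only [synEntry, decide_eq_true_eq]
  · rw [h.entry_eq s e hse, synEntry]

end IsSyntactic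

theorem exists_isSyntactic (hR : IsStrictResetFunction (synReset L)) (hK : K' ≤ minConst L)
    (hshape : IsTableShape S' E') :
    ∃ T : ObsTable α, T.K = K' ∧ T.S = S' ∧ T.E = E' ∧ T.IsSyntactic L := by
  classical
  refine ⟨{ hshape with
    K := K'
    S := S'
    E := E'
    entry := fun s e => if (s, e) ∈ cells K' S' E' then synEntry L (s ++ e) else (false, 0)
    range_entry := fun s e hse => ?_
    entry_default := fun s e hse => if_neg hse }, rfl, rfl, rfl, hK, fun s e hse => if_pos hse⟩
  rw [if_pos hse]
  exact ⟨hR.isHalfInt (isHIWord_of_mem_cells hshape.hi_S hshape.hi_E hse), hR.not_posInt _⟩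

theorem IsSyntactic.exists_mem_copies (hT : T.IsSyntactic L)
    (hR : IsStrictResetFunction (synReset L)) (hK' : K' ≤ minConst L)
    (h : T.IsExtendedBy K' S' E') : ∃ T' ∈ T.copies L K' S' E', T'.IsSyntactic L := by
  obtain ⟨T', rfl, rfl, rfl, hT'⟩ := exists_isSyntactic hR hK' h.toIsTableShape
  refine ⟨T', ⟨rfl, rfl, rfl, hT'.filled hR, fun s e hse => ?_⟩, hT'⟩
  rw [hT.entry_eq s e hse, hT'.entry_eq s e (cells_mono h.le h.subset_S h.subset_E hse)]

theorem mem_S_of_snoc_mem {p : ℝ≥0 × α} (h : s ++ [p] ∈ T.S ∪ extensions T.K T.S) : s ∈ T.S := by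
  obtain h | ⟨s', hs', p', -, h⟩ := h
  · exact T.prefix_S _ h s (List.prefix_append _ _)
  · exact (List.append_inj' h rfl).1 ▸ hs'

variable [Finite α]

theorem IsSyntactic.consistentB (hT : T.IsSyntactic L) (hL : IsDTARecognizable L)
    (hK : minConst L ≤ T.K) : T.ConsistentB := by
  intro s t a hsa hlt
  have hs := mem_S_of_snoc_mem hsa
  have hK' : (minConst L : ℝ≥0) ≤ T.K := Nat.cast_le.2 hK
  have ht : (minConst L : ℝ≥0) < synReset L s + t := hK'.trans_lt (hT.r_eq hs ▸ hlt)
  have ht' : (minConst L : ℝ≥0) < synReset L s + (T.K + 1 / 2) :=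
    hK'.trans_lt ((lt_add_of_pos_right _ (by norm_num)).trans_le le_add_self)
  rw [hT.row_eq hsa,
    hT.row_eq (.inr (snoc_mem_extensions hs (natCast_add_half_mem_sigmaK _ _)))]
  refine funext fun e => synEntry_append_congr ?_ (hL.residualLang_snoc_of_minConst_lt ht ht') e
  rw [hL.synReset_snoc_of_minConst_lt ht, hL.synReset_snoc_of_minConst_lt ht']

theorem IsSyntactic.le_of_action (hT : T.IsSyntactic L) (hL : IsDTARecognizable L)
    (h : T.Action K' S' E') : K' ≤ minConst L := by
  cases h with
  | close => exact hT.le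
  | distinguish => exact hT.le
  | enlarge h => exact Nat.lt_of_not_le fun hK => h (hT.consistentB hL hK)
  | validate s e hse h =>
      rw [hT.entry_eq s e hse] at h
      exact Nat.cast_lt.1 (h.trans_le (hL.synReset_le_minConst _))

omit [Finite α] in
theorem IsSyntactic.level_lt_of_action (hT : T.IsSyntactic L) (h : T.Action K' S' E') :
    T.level < K' + rowCount L S' E' := by
  rw [hT.level_eq]
  cases h with
  | close w hw hne =>
      have hnotMem : synRow L T.E w ∉ synRow L T.E '' T.S := by
        rintro ⟨s, hs, hrow⟩
        exact hne s hs (by rw [hT.row_eq (.inr hw), hT.row_eq (.inl hs), hrow])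
      rw [rowCount, rowCount, Set.union_singleton, Set.image_insert_eq,
        Set.ncard_insert_of_notMem hnotMem (T.finite_S.image _)]
      exact Nat.lt_succ_self _
  | distinguish s₁ s₂ p e hs₁ hs₂ hp he hrow hne =>
      rw [hT.row_eq (.inl hs₁), hT.row_eq (.inl hs₂)] at hrow
      rw [hT.entry_eq _ _ ⟨.inr (snoc_mem_extensions hs₁ hp), he⟩,
        hT.entry_eq _ _ ⟨.inr (snoc_mem_extensions hs₂ hp), he⟩, List.append_assoc,
        List.append_assoc] at hne
      have hpe : p :: e ∈ T.E ∪ {p :: e} := .inr rfl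
      exact Nat.add_lt_add_left (rowCount_lt_right T.finite_S Set.subset_union_left hs₁ hs₂ hrow
        fun h => hne (congrFun h ⟨p :: e, hpe⟩)) _
  | _ => omega

theorem IsSyntactic.exists_copy_of_action (hT : T.IsSyntactic L) (hL : IsDTARecognizable L)
    (h : T.Action K' S' E') :
    ∃ T' ∈ T.copies L K' S' E', T'.IsSyntactic L ∧ T.level < T'.level := by
  obtain ⟨T', hT', hsyn⟩ := hT.exists_mem_copies hL.isStrictResetFunction_synReset
    (hT.le_of_action hL h) h.isExtendedBy
  have hlevel := hT.level_lt_of_action h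
  obtain ⟨rfl, rfl, rfl, -⟩ := id hT'
  exact ⟨T', hT', hsyn, hsyn.level_eq ▸ hlevel⟩

/-! ### Counterexamples -/

omit [Finite α] in
theorem Ready.exists_mem_sigmaK_of_snoc_mem {t : ℝ≥0} {a : α} (h : T.Ready)
    (hs : s ++ [(t, a)] ∈ T.S) :
    ∃ t', (t', a) ∈ sigmaK α T.K ∧ KRegionEquiv T.K (T.r s + t') (T.r s + t) ∧
      T.row (s ++ [(t', a)]) = T.row (s ++ [(t, a)]) := by
  by_cases hK : T.r s + t ≤ T.K
  · have ht : IsHalfInt t := isHIWord_singleton.1 (isHIWord_append.1 (T.hi_S _ hs)).2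
    exact ⟨t, ht.mem_sigmaK_of_le (le_add_self.trans hK) a, .refl _ _, rfl⟩
  · refine ⟨_, natCast_add_half_mem_sigmaK T.K a, .of_gt ?_ (not_le.1 hK),
      (h.consistentB s t a (.inl hs) (not_le.1 hK)).symm⟩
    exact (lt_add_of_pos_right _ (by norm_num)).trans_le le_add_self

theorem IsSyntactic.exists_run_conj_normalForm (hT : T.IsSyntactic L) (hL : IsDTARecognizable L)
    (hready : T.Ready) {u : TimedWord α} (hu : normalForm (synReset L) u ∈ T.S) :
    ∃ θs, T.conj.Run T.conj.init 0 u θs (T.state ⟨_, hu⟩) (synReset L u) := by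
  induction u using List.reverseRecOn with
  | nil => exact ⟨[], .nil _ _⟩
  | append_singleton u p ih =>
      obtain ⟨t, a⟩ := p
      have hsnoc := hu
      rw [normalForm_snoc] at hsnoc
      have hpre := T.prefix_S _ hsnoc _ (List.prefix_append _ _)
      obtain ⟨θs, hrun⟩ := ih hpre
      have hr : ∀ {u}, normalForm (synReset L) u ∈ T.S →
          T.r (normalForm (synReset L) u) = hi (synReset L u) := fun hu => by
        rw [hT.r_eq hu, hL.synReset_normalForm]
      obtain ⟨t', ht', hequiv, hrow⟩ := hready.exists_mem_sigmaK_of_snoc_mem hsnoc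
      rw [hr hpre, add_tsub_cancel_of_le (hi_mono le_self_add), ← hr hpre] at hequiv
      rw [← normalForm_snoc] at hrow
      obtain ⟨θs', hrun'⟩ := exists_run_conj_snoc (s' := ⟨_, hu⟩) hrun ht' hrow
        (hequiv.trans (kRegionEquiv_hi T.K _).symm)
      refine ⟨θs', ?_⟩
      have hclock : synReset L (u ++ [(t, a)]) =
          if T.r (normalForm (synReset L) (u ++ [(t, a)])) = 0 then 0 else synReset L u + t := by
        simp only [hr hu, hi_eq_zero_iff]
        split_ifs with h0
        · exact h0
        · exact ((isResetFunction_synReset L).snoc u t a).resolve_left h0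
      rwa [hclock]

theorem IsSyntactic.mem_lang_conj_iff (hT : T.IsSyntactic L) (hL : IsDTARecognizable L)
    (hready : T.Ready) {u : TimedWord α} (hu : normalForm (synReset L) u ∈ T.S) :
    u ∈ T.conj.lang ↔ u ∈ L := by
  obtain ⟨θs, hrun⟩ := hT.exists_run_conj_normalForm hL hready hu
  rw [hready.isDeterministic_conj.mem_lang_iff hrun, ← hL.normalForm_mem_iff u]
  have hcell := (hT.filled hL.isStrictResetFunction_synReset).1 _ _ (mem_cells_nil (.inl hu))
  rwa [List.append_nil] at hcell

theorem Ready.lang_conj_eq_of_mem_copies (hT : T.Ready) (hT' : T'.Ready) (hF : T.Filled L)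
    (hcopy : T' ∈ T.copies L T.K S' T.E) (hS : T.S ⊆ S') : T'.conj.lang = T.conj.lang := by
  obtain ⟨hK, rfl, hE, -, hentry⟩ := hcopy
  have hsub : ∀ {s}, s ∈ T.S ∪ extensions T.K T.S → ∀ e ∈ T.E, T'.entry s e = T.entry s e :=
    fun hs e he => hentry _ e ⟨hs, he⟩
  have hruns : ∀ w, ∃ (s : T.S) (ν : ℝ≥0), (∃ θs, T.conj.Run T.conj.init 0 w θs (T.state s) ν) ∧
      ∃ θs, T'.conj.Run T'.conj.init 0 w θs (T'.state ⟨s, hS s.2⟩) ν := by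
    intro w
    induction w using List.reverseRecOn with
    | nil => exact ⟨⟨[], T.nil_mem_S⟩, 0, ⟨_, .nil _ _⟩, _, .nil _ _⟩
    | append_singleton w p ih =>
        obtain ⟨s, ν, ⟨θs, hrun⟩, θs', hrun'⟩ := ih
        obtain ⟨t', ht', hequiv⟩ := hT.exists_mem_sigmaK s.2 (hF.kRegionEquiv_clock hrun) p.1 p.2
        have hext := snoc_mem_extensions s.2 ht'
        obtain ⟨s', hs', hrow⟩ := hT.closed _ hext
        have hr : ∀ {s}, s ∈ T.S → T'.r s = T.r s := fun hs =>
          congrArg Prod.snd (hsub (.inl hs) _ T.nil_mem_E)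
        have hrow' : T'.row (s ++ [(t', p.2)]) = T'.row s' := row_eq_iff.2 fun e he => by
          rw [hE] at he
          rw [hsub (.inr hext) e he, hsub (.inl hs') e he, row_eq_iff.1 hrow e he]
        refine ⟨⟨s', hs'⟩, _, exists_run_conj_snoc hrun ht' hrow hequiv, ?_⟩
        simp only [← hr hs']
        exact exists_run_conj_snoc (s' := ⟨s', hS hs'⟩) hrun' (hK ▸ ht') hrow'
          (hK ▸ hr s.2 ▸ hequiv)
  ext w
  obtain ⟨s, ν, ⟨θs, hrun⟩, θs', hrun'⟩ := hruns w
  rw [hT.isDeterministic_conj.mem_lang_iff hrun, hT'.isDeterministic_conj.mem_lang_iff hrun']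
  exact (congrArg (·.1 = true) (hsub (.inl s.2) _ T.nil_mem_E)).to_iff

theorem IsSyntactic.exists_copy_of_counterexample (hT : T.IsSyntactic L)
    (hL : IsDTARecognizable L) (hready : T.Ready) {w : TimedWord α}
    (hw : ¬ (w ∈ T.conj.lang ↔ w ∈ L)) :
    ∃ T' ∈ T.copies L T.K (T.refineRows w) T.E, T'.IsSyntactic L ∧
      T.level ≤ T'.level ∧ ¬ T'.Ready := by
  have hR := hL.isStrictResetFunction_synReset
  have hext := T.isExtendedBy_refineRows w
  obtain ⟨T', hT', hsyn⟩ := hT.exists_mem_copies hR hT.le hext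
  refine ⟨T', hT', hsyn, ?_, fun hready' => hw ?_⟩
  · rw [hT.level_eq, hsyn.level_eq, hT'.1, hT'.2.1, hT'.2.2.1]
    exact Nat.add_le_add_left (rowCount_mono_left hext.finite_S hext.subset_S) _
  · rw [← hready.lang_conj_eq_of_mem_copies hready' (hT.filled hR) hT' hext.subset_S]
    refine hsyn.mem_lang_conj_iff hL hready' ?_
    rw [hT'.2.1]
    exact .inr ⟨_, ⟨_, hR.toIsResetFunction, rfl⟩, List.prefix_rfl⟩

end ObsTable

/-! ### Counting reset assignments -/

section HalfIntegers

variable {x y : ℝ≥0}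

theorem isNonInt_div_two_iff {k : ℕ} : IsNonInt (k / 2 : ℝ≥0) ↔ Odd k := by
  have hsum := floor_add_ceil_div_two k
  have hceil := Nat.ceil_le_floor_add_one (k / 2 : ℝ≥0)
  have hfloor := Nat.floor_le_ceil (k / 2 : ℝ≥0)
  rw [isNonInt_iff_floor_lt_ceil, Nat.odd_iff]
  omega

theorem IsHalfInt.isNonInt_add_iff (hx : IsHalfInt x) (hy : IsHalfInt y) :
    IsNonInt (x + y) ↔ (IsNonInt x ↔ ¬ IsNonInt y) := by
  obtain ⟨j, rfl⟩ := hx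
  obtain ⟨k, rfl⟩ := hy
  rw [← add_div, ← Nat.cast_add, isNonInt_div_two_iff, isNonInt_div_two_iff, isNonInt_div_two_iff,
    Nat.odd_add, Nat.not_odd_iff_even]

end HalfIntegers

theorem IsStrictResetFunction.isNonInt_iff {α : Type u} {R : TimedWord α → ℝ≥0}
    (hR : IsStrictResetFunction R) (w : TimedWord α) : IsNonInt (R w) ↔ R w ≠ 0 :=
  ⟨IsNonInt.ne_zero, (not_isPosInt_iff.1 (hR.not_posInt w)).resolve_left⟩

theorem IsStrictResetFunction.ne_zero_iff_of_snoc_ne_zero {α : Type u} {R : TimedWord α → ℝ≥0}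
    (hR : IsStrictResetFunction R) {w : TimedWord α} {t : ℝ≥0} {a : α} (hw : IsHIWord w)
    (ht : IsHalfInt t) (h : R (w ++ [(t, a)]) ≠ 0) : R w ≠ 0 ↔ ¬ IsNonInt t := by
  rw [← hR.isNonInt_iff, ← (hR.isHalfInt hw).isNonInt_add_iff ht,
    ← (hR.snoc w t a).resolve_left h, hR.isNonInt_iff]
  exact h

theorem IsStrictResetFunction.eq_of_ne_zero {α : Type u} {R R' : TimedWord α → ℝ≥0}
    (hR : IsStrictResetFunction R) (hR' : IsStrictResetFunction R') {w : TimedWord α}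
    (hw : IsHIWord w) (h : R w ≠ 0) (h' : R' w ≠ 0) : R w = R' w := by
  induction w using List.reverseRecOn with
  | nil => exact absurd hR.nil h
  | append_singleton w p ih =>
      obtain ⟨t, a⟩ := p
      rw [isHIWord_append, isHIWord_singleton] at hw
      have hne : R w ≠ 0 ↔ R' w ≠ 0 := (hR.ne_zero_iff_of_snoc_ne_zero hw.1 hw.2 h).trans
        (hR'.ne_zero_iff_of_snoc_ne_zero hw.1 hw.2 h').symm
      rw [(hR.snoc w t a).resolve_left h, (hR'.snoc w t a).resolve_left h']
      congr 1
      by_cases h0 : R w = 0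
      · rw [h0, not_ne_iff.1 (mt hne.2 (not_ne_iff.2 h0))]
      · exact ih hw.1 h0 (hne.1 h0)

section CellCount

variable {α : Type u} {S E : Set (TimedWord α)}

theorem extensions_eq_image (K : ℕ) (S : Set (TimedWord α)) :
    extensions K S = (fun x : TimedWord α × ℝ≥0 × α => x.1 ++ [x.2]) '' S ×ˢ sigmaK α K := by
  ext w
  constructor
  · rintro ⟨s, hs, p, hp, rfl⟩
    exact ⟨(s, p), ⟨hs, hp⟩, rfl⟩
  · rintro ⟨⟨s, p⟩, ⟨hs, hp⟩, rfl⟩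
    exact ⟨s, hs, p, hp, rfl⟩

theorem finite_cells [Finite α] (K : ℕ) (hS : S.Finite) (hE : E.Finite) :
    (cells K S E).Finite := by
  refine (hS.union ?_).prod hE
  rw [extensions_eq_image]
  exact (hS.prod (sigmaK_finite α K)).image _

theorem ncard_sigmaK_le (α : Type u) [Fintype α] (K : ℕ) :
    (sigmaK α K).ncard ≤ Fintype.card α * (2 * K + 2) := by
  have hsub : sigmaK α K ⊆
      Set.range fun i : Fin (2 * K + 2) × α => ((i.1 / 2, i.2) : ℝ≥0 × α) := by
    rintro ⟨_, a⟩ ⟨⟨k, rfl⟩, hlt⟩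
    rw [div_lt_iff₀ two_pos] at hlt
    have hk : k < (K + 1) * 2 := by exact_mod_cast hlt
    exact ⟨(⟨k, by omega⟩, a), rfl⟩
  calc (sigmaK α K).ncard ≤ Nat.card (Fin (2 * K + 2) × α) :=
        (Set.ncard_le_ncard hsub (Set.finite_range _)).trans (Finite.card_range_le _)
    _ = Fintype.card α * (2 * K + 2) := by
        rw [Nat.card_eq_fintype_card, Fintype.card_prod, Fintype.card_fin, mul_comm]

theorem ncard_cells_le [Fintype α] (K : ℕ) (hS : S.Finite) :
    (cells K S E).ncard ≤ S.ncard * (1 + Fintype.card α * (2 * K + 2)) * E.ncard := by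
  have hext : (extensions K S).ncard ≤ S.ncard * (Fintype.card α * (2 * K + 2)) := by
    rw [extensions_eq_image]
    refine (Set.ncard_image_le (hS.prod (sigmaK_finite α K))).trans ?_
    rw [Set.ncard_prod]
    exact Nat.mul_le_mul_left _ (ncard_sigmaK_le α K)
  rw [cells, Set.ncard_prod, mul_add, mul_one]
  exact Nat.mul_le_mul_right _ ((Set.ncard_union_le _ _).trans (Nat.add_le_add_left hext _))

end CellCount

namespace ObsTable

variable {α : Type u} {L : Set (TimedWord α)} {K K' : ℕ} {S E S' E' : Set (TimedWord α)}
  {B : Set (TimedWord α × TimedWord α)} {P : Set (ObsTable α)} {T T' : ObsTable α}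

/-- The tables with parameters `(K, S, E)` filled for the language `L`, one for each possible reset
assignment. -/
def filledTables (L : Set (TimedWord α)) (K : ℕ) (S E : Set (TimedWord α)) : Set (ObsTable α) :=
  {T | T.K = K ∧ T.S = S ∧ T.E = E ∧ T.Filled L}

theorem copies_subset_filledTables (T : ObsTable α) :
    T.copies L K' S' E' ⊆ filledTables L K' S' E' :=
  fun _ h => ⟨h.1, h.2.1, h.2.2.1, h.2.2.2.1⟩

theorem ext_of_entry (hK : T.K = T'.K) (hS : T.S = T'.S) (hE : T.E = T'.E)
    (h : T.entry = T'.entry) : T = T' := by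
  cases T
  cases T'
  congr

theorem entry_eq_of_mem_filledTables (hT : T ∈ filledTables L K S E)
    (hT' : T' ∈ filledTables L K S E) {s e : TimedWord α} (hse : (s, e) ∈ cells K S E)
    (h : (T.entry s e).2 = 0 ↔ (T'.entry s e).2 = 0) : T.entry s e = T'.entry s e := by
  obtain ⟨rfl, rfl, rfl, hF, R, hR, hRT⟩ := hT
  obtain ⟨hK, hS, hE, hF', R', hR', hRT'⟩ := hT'
  rw [hK, hS, hE] at hF' hRT'
  refine Prod.ext (Bool.eq_iff_iff.2 ((hF s e hse).trans (hF' s e hse).symm)) ?_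
  by_cases h0 : (T.entry s e).2 = 0
  · rw [h0, h.1 h0]
  · have h0' := mt h.2 h0
    rw [hRT s e hse] at h0 ⊢
    rw [hRT' s e hse] at h0' ⊢
    exact hR.eq_of_ne_zero hR' (isHIWord_of_mem_cells T.hi_S T.hi_E hse) h0 h0'

open Classical in
/-- The cells of `C` in which the reset component of the table vanishes, as an indicator
function. -/
noncomputable def zeroPattern (C : Set (TimedWord α × TimedWord α)) (T : ObsTable α) : C → Bool :=
  fun c => decide ((T.entry c.1.1 c.1.2).2 = 0)

theorem injOn_zeroPattern (hP : P ⊆ filledTables L K S E)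
    (hB : ∀ T ∈ P, ∀ T' ∈ P, ∀ s e, (s, e) ∈ B → T.entry s e = T'.entry s e) :
    Set.InjOn (zeroPattern (cells K S E \ B)) P := by
  intro T hT T' hT' hzero
  obtain ⟨hK, hS, hE, -⟩ := hP hT
  obtain ⟨hK', hS', hE', -⟩ := hP hT'
  refine ext_of_entry (hK.trans hK'.symm) (hS.trans hS'.symm) (hE.trans hE'.symm)
    (funext fun s => funext fun e => ?_)
  by_cases hmemB : (s, e) ∈ B
  · exact hB T hT T' hT' s e hmemB
  by_cases hse : (s, e) ∈ cells K S E
  · exact entry_eq_of_mem_filledTables (hP hT) (hP hT') hse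
      (decide_eq_decide.1 (congrFun hzero ⟨(s, e), hse, hmemB⟩))
  · rw [T.entry_default s e (by rwa [hK, hS, hE]), T'.entry_default s e (by rwa [hK', hS', hE'])]

theorem finite_filledTables (hfin : (cells K S E).Finite) : (filledTables L K S E).Finite := by
  have := hfin.sdiff (t := ∅) |>.to_subtype
  exact Set.Finite.of_finite_image (Set.toFinite _)
    (injOn_zeroPattern (B := ∅) subset_rfl fun _ _ _ _ _ _ h => h.elim)

theorem ncard_le_two_pow_ncard_sdiff (hfin : (cells K S E).Finite)
    (hP : P ⊆ filledTables L K S E)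
    (hB : ∀ T ∈ P, ∀ T' ∈ P, ∀ s e, (s, e) ∈ B → T.entry s e = T'.entry s e) :
    P.ncard ≤ 2 ^ (cells K S E \ B).ncard := by
  have := hfin.sdiff (t := B) |>.to_subtype
  calc P.ncard = (zeroPattern (cells K S E \ B) '' P).ncard :=
        (injOn_zeroPattern hP hB).ncard_image.symm
    _ ≤ Nat.card (↥(cells K S E \ B) → Bool) := Set.ncard_le_card _
    _ = 2 ^ (cells K S E \ B).ncard := by
        rw [Nat.card_fun, Nat.card_eq_fintype_card (α := Bool), Fintype.card_bool,
          Nat.card_coe_set_eq]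

/-! ### Weights of pools -/

open scoped ENNReal

/-- The weight of a table, halved for each cell, so that by the binary choice in each new cell a
table has at least the total weight of its copies. -/
noncomputable def weight (T : ObsTable α) : ℝ≥0∞ := 2⁻¹ ^ (cells T.K T.S T.E).ncard

/-- The total weight of a pool. -/
noncomputable def poolWeight (P : Set (ObsTable α)) : ℝ≥0∞ := ∑' T : P, weight T.1

theorem poolWeight_empty : poolWeight (∅ : Set (ObsTable α)) = 0 := tsum_empty

theorem poolWeight_union_le (P P' : Set (ObsTable α)) :
    poolWeight (P ∪ P') ≤ poolWeight P + poolWeight P' :=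
  ENNReal.tsum_union_le _ _ _

theorem weight_add_poolWeight_sdiff_singleton (hT : T ∈ P) :
    weight T + poolWeight (P \ {T}) = poolWeight P := by
  have hunion : poolWeight ({T} ∪ P \ {T}) = poolWeight {T} + poolWeight (P \ {T}) :=
    ENNReal.summable.tsum_union_disjoint Set.disjoint_sdiff_right ENNReal.summable
  have hsingle : poolWeight {T} = weight T := tsum_singleton T weight
  rw [← hsingle, ← hunion, Set.union_sdiff_cancel (Set.singleton_subset_iff.2 hT)]

theorem poolWeight_le (hfin : (cells K S E).Finite) (hBsub : B ⊆ cells K S E)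
    (hP : P ⊆ filledTables L K S E)
    (hB : ∀ T ∈ P, ∀ T' ∈ P, ∀ s e, (s, e) ∈ B → T.entry s e = T'.entry s e) :
    poolWeight P ≤ 2⁻¹ ^ B.ncard := by
  have hweight : ∀ T ∈ P, weight T = 2⁻¹ ^ (cells K S E).ncard := fun T hT => by
    obtain ⟨rfl, rfl, rfl, -⟩ := hP hT
    rfl
  have hcard : (P.ncard : ℝ≥0∞) ≤ 2 ^ (cells K S E \ B).ncard := by
    exact_mod_cast ncard_le_two_pow_ncard_sdiff hfin hP hB
  have hPfin : P.Finite := (finite_filledTables hfin).subset hP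
  calc poolWeight P = ∑' _ : P, (2⁻¹ : ℝ≥0∞) ^ (cells K S E).ncard :=
        tsum_congr fun T => hweight T.1 T.2
    _ = P.ncard * 2⁻¹ ^ (cells K S E \ B).ncard * 2⁻¹ ^ B.ncard := by
        rw [ENNReal.tsum_set_const, ← hPfin.cast_ncard_eq, ENat.toENNReal_coe, mul_assoc, ← pow_add,
          Set.ncard_sdiff_add_ncard_of_subset hBsub hfin]
    _ ≤ 2 ^ (cells K S E \ B).ncard * 2⁻¹ ^ (cells K S E \ B).ncard * 2⁻¹ ^ B.ncard := by gcongr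
    _ = 2⁻¹ ^ B.ncard := by
        rw [← mul_pow, ENNReal.mul_inv_cancel two_ne_zero ENNReal.ofNat_ne_top, one_pow, one_mul]

theorem poolWeight_copies_le [Finite α] (h : T.IsExtendedBy K' S' E') :
    poolWeight (T.copies L K' S' E') ≤ T.weight :=
  poolWeight_le (finite_cells K' h.finite_S h.finite_E)
    (cells_mono h.le h.subset_S h.subset_E) T.copies_subset_filledTables
    fun _ h₁ _ h₂ s e hse => (h₁.2.2.2.2 s e hse).trans (h₂.2.2.2.2 s e hse).symm

end ObsTable

/-! ### Sizes of tables -/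

section Arithmetic

variable {m σ H a b c : ℕ}

theorem two_mul_two_pow_sub_one_le (hm : 1 ≤ m) : 2 * (2 ^ m - 1) ≤ m * 2 ^ m := by
  rcases hm.eq_or_lt with rfl | hm
  · norm_num
  · exact Nat.mul_le_mul hm (Nat.sub_le _ _)

theorem one_le_two_pow_sub_one (hm : 1 ≤ m) : 1 ≤ 2 ^ m - 1 := by
  have := Nat.lt_two_pow_self (n := m)
  omega

theorem two_mul_le_two_pow_add_one (H : ℕ) : 2 * H ≤ 2 ^ H + 1 := by
  cases H with
  | zero => norm_num
  | succ n =>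
      have := Nat.lt_two_pow_self (n := n)
      rw [pow_succ]
      omega

theorem twentySeven_mul_le (x y z : ℕ) : 27 * (x * y * z) ≤ (x + y + z) ^ 3 := by
  zify
  have hx : (0 : ℤ) ≤ x := by positivity
  have hy : (0 : ℤ) ≤ y := by positivity
  have hz : (0 : ℤ) ≤ z := by positivity
  nlinarith [mul_nonneg hx (sq_nonneg (y - z : ℤ)), mul_nonneg hy (sq_nonneg (x - z : ℤ)),
    mul_nonneg hz (sq_nonneg (x - y : ℤ)),
    mul_nonneg (add_nonneg (add_nonneg hx hy) hz)
      (add_nonneg (add_nonneg (sq_nonneg (x - y : ℤ)) (sq_nonneg (x - z : ℤ)))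
        (sq_nonneg (y - z : ℤ)))]

theorem cellBound_le {M : ℕ} (hM : 1 ≤ M) (hσ : 1 ≤ σ) :
    (1 + a * M) * (1 + σ * (2 * c + 2)) * (1 + b) ≤
      3 * (M * σ) * ((1 + a) * (1 + b) * (1 + c)) := by
  have hrows : 1 + a * M ≤ (1 + a) * M := by nlinarith
  have hextensions : 1 + σ * (2 * c + 2) ≤ 3 * σ * (1 + c) := by nlinarith [Nat.zero_le (σ * c)]
  calc (1 + a * M) * (1 + σ * (2 * c + 2)) * (1 + b)
      ≤ (1 + a) * M * (3 * σ * (1 + c)) * (1 + b) := by gcongr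
    _ = _ := by ring

theorem two_mul_add_one_pow_three_add_le (hH : 2 ≤ H) :
    (2 * H + 1) ^ 3 + 9 * (H - 2) ≤ 18 * H ^ 3 := by
  obtain ⟨k, rfl⟩ := Nat.exists_eq_add_of_le hH
  rw [Nat.add_sub_cancel_left]
  ring_nf
  nlinarith

theorem cellBound_add_le_of_two_le {P : ℕ} (hP : 1 ≤ P) (hH : 2 ≤ H) (h : a + b + c + 2 ≤ 2 * H) :
    3 * P * ((1 + a) * (1 + b) * (1 + c)) + H ≤ 2 * P * H ^ 3 + 2 := by
  have hamgm : 27 * ((1 + a) * (1 + b) * (1 + c)) ≤ (2 * H + 1) ^ 3 :=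
    (twentySeven_mul_le _ _ _).trans (Nat.pow_le_pow_left (by omega) 3)
  refine Nat.le_of_mul_le_mul_left (c := 9) ?_ (by norm_num)
  calc 9 * (3 * P * ((1 + a) * (1 + b) * (1 + c)) + H)
      = P * (27 * ((1 + a) * (1 + b) * (1 + c))) + 1 * (9 * (H - 2)) + 18 := by
        obtain ⟨k, rfl⟩ := Nat.exists_eq_add_of_le hH
        rw [Nat.add_sub_cancel_left]
        ring
    _ ≤ P * (2 * H + 1) ^ 3 + P * (9 * (H - 2)) + 18 := by gcongr
    _ = P * ((2 * H + 1) ^ 3 + 9 * (H - 2)) + 18 := by ring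
    _ ≤ P * (18 * H ^ 3) + 18 := by gcongr; exact two_mul_add_one_pow_three_add_le hH
    _ = 9 * (2 * P * H ^ 3 + 2) := by ring

theorem cellBound_add_le (hm : 1 ≤ m) (hσ : 1 ≤ σ) (h : a + b + c + 2 ≤ 2 * H) :
    (1 + a * (2 ^ m - 1)) * (1 + σ * (2 * c + 2)) * (1 + b) + H ≤
      H ^ 3 * m * 2 ^ m * σ + 2 := by
  have hM := one_le_two_pow_sub_one hm
  suffices (1 + a * (2 ^ m - 1)) * (1 + σ * (2 * c + 2)) * (1 + b) + H ≤
      2 * ((2 ^ m - 1) * σ) * H ^ 3 + 2 from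
    calc _ ≤ 2 * ((2 ^ m - 1) * σ) * H ^ 3 + 2 := this
      _ = 2 * (2 ^ m - 1) * σ * H ^ 3 + 2 := by ring
      _ ≤ m * 2 ^ m * σ * H ^ 3 + 2 := by
        gcongr ?_ * σ * H ^ 3 + 2
        exact two_mul_two_pow_sub_one_le hm
      _ = _ := by ring
  obtain rfl | hH : H = 1 ∨ 2 ≤ H := by omega
  · obtain ⟨rfl, rfl, rfl⟩ : a = 0 ∧ b = 0 ∧ c = 0 := by omega
    have := Nat.le_mul_of_pos_left σ hM
    omega
  · exact (Nat.add_le_add_right (cellBound_le hM hσ) H).trans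
      (cellBound_add_le_of_two_le (Nat.mul_pos hM hσ) hH h)

theorem cellBound_le_mul (hm : 1 ≤ m) (hσ : 1 ≤ σ) (h : a + b + c + 1 ≤ 2 * H) :
    (1 + a * (2 ^ m - 1)) * (1 + σ * (2 * c + 2)) * (1 + b) ≤ 24 * (H ^ 3 * m * 2 ^ m * σ) := by
  have hM : 2 ^ m - 1 ≤ m * 2 ^ m := by linarith [two_mul_two_pow_sub_one_le hm]
  calc (1 + a * (2 ^ m - 1)) * (1 + σ * (2 * c + 2)) * (1 + b)
      ≤ 3 * ((2 ^ m - 1) * σ) * ((1 + a) * (1 + b) * (1 + c)) :=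
        cellBound_le (one_le_two_pow_sub_one hm) hσ
    _ ≤ 3 * (m * 2 ^ m * σ) * (2 * H * (2 * H) * (2 * H)) := by gcongr <;> omega
    _ = _ := by ring

end Arithmetic

/-- The exponent `H³m2ᵐ|Σ|` in the bounds on tables and queries, which up to an additive constant
also bounds the number of cells of a table that is processed. -/
def sizeBound (α : Type u) [Fintype α] (H m : ℕ) : ℕ :=
  H ^ 3 * m * 2 ^ m * Fintype.card α

/-- The parameters of a table have a size that `i` rounds with counterexamples of length at most
`m` can produce: `a` rounds extend the row words, `b` the column words and `c` the constant. -/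
def IsSized {α : Type u} (m i K : ℕ) (S E : Set (TimedWord α)) : Prop :=
  ∃ a b c : ℕ, a + b + c ≤ i ∧ S.ncard ≤ 1 + a * (2 ^ m - 1) ∧ E.ncard ≤ 1 + b ∧ K ≤ c

namespace IsSized

variable {α : Type u} {T : ObsTable α} {m i K H : ℕ} {S E : Set (TimedWord α)}

theorem singleton_nil (m i : ℕ) :
    IsSized m i 0 ({[]} : Set (TimedWord α)) ({[]} : Set (TimedWord α)) :=
  ⟨0, 0, 0, by simp⟩

theorem action {K' : ℕ} {S' E' : Set (TimedWord α)} (hT : IsSized m i T.K T.S T.E)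
    (h : T.Action K' S' E') (hm : 1 ≤ m) : IsSized m (i + 1) K' S' E' := by
  obtain ⟨a, b, c, habc, hS, hE, hK⟩ := hT
  cases h with
  | close w =>
      refine ⟨a + 1, b, c, by omega, ?_, hE, hK⟩
      have hM := one_le_two_pow_sub_one hm
      have hncard := Set.ncard_union_le T.S {w}
      rw [Set.ncard_singleton] at hncard
      rw [add_mul, one_mul]
      omega
  | distinguish s₁ s₂ p e =>
      refine ⟨a, b + 1, c, by omega, hS, ?_, hK⟩
      have hncard := Set.ncard_union_le T.E {p :: e}
      rw [Set.ncard_singleton] at hncard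
      omega
  | enlarge => exact ⟨a, b, c + 1, by omega, hS, hE, by omega⟩
  | validate => exact ⟨a, b, c + 1, by omega, hS, hE, by omega⟩

theorem refineRows {w : TimedWord α} (hT : IsSized m i T.K T.S T.E) (hw : w.length ≤ m) :
    IsSized m (i + 1) T.K (T.refineRows w) T.E := by
  obtain ⟨a, b, c, habc, hS, hE, hK⟩ := hT
  refine ⟨a + 1, b, c, by omega, ?_, hE, hK⟩
  have hsubset := Set.ncard_le_ncard (T.refineRows_subset w)
    (T.finite_S.union (finite_normalPrefixes 0 w))
  have hunion := Set.ncard_union_le T.S (normalPrefixes 0 w)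
  have hprefixes := ncard_normalPrefixes_add_one_le 0 w
  have hpow : 2 ^ w.length ≤ 2 ^ m := Nat.pow_le_pow_right two_pos hw
  rw [add_mul, one_mul]
  omega

variable [Fintype α] [Nonempty α]

theorem ncard_cells_add_le (h : IsSized m i K S E) (hS : S.Finite) (hm : 1 ≤ m)
    (hi : i + 2 ≤ 2 * H) :
    (cells K S E).ncard + H ≤ sizeBound α H m + 2 := by
  obtain ⟨a, b, c, habc, hSa, hEb, hKc⟩ := h
  calc (cells K S E).ncard + H
      ≤ (1 + a * (2 ^ m - 1)) * (1 + Fintype.card α * (2 * c + 2)) * (1 + b) + H := by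
        refine Nat.add_le_add_right ((ncard_cells_le K hS).trans ?_) H
        gcongr
    _ ≤ _ := cellBound_add_le hm Fintype.card_pos (by omega)

theorem ncard_cells_le (h : IsSized m i K S E) (hS : S.Finite) (hm : 1 ≤ m)
    (hi : i + 1 ≤ 2 * H) :
    (cells K S E).ncard ≤ 24 * sizeBound α H m := by
  obtain ⟨a, b, c, habc, hSa, hEb, hKc⟩ := h
  calc (cells K S E).ncard
      ≤ (1 + a * (2 ^ m - 1)) * (1 + Fintype.card α * (2 * c + 2)) * (1 + b) := by
        refine (_root_.ncard_cells_le K hS).trans ?_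
        gcongr
    _ ≤ _ := cellBound_le_mul hm Fintype.card_pos (by omega)

end IsSized

/-! ### The invariant of the algorithm -/

namespace ObsTable

variable {α : Type u} [Finite α] {T : ObsTable α} {L : Set (TimedWord α)} {i : ℕ}

/-- `T` is a syntactic table whose level is large enough for round `i`. Two rounds raise the level
by at least one: a counterexample need not raise it, but leaves a table that is not ready, to which
an action applies in the next round. -/
def OnTrack (L : Set (TimedWord α)) (i : ℕ) (T : ObsTable α) : Prop :=
  T.IsSyntactic L ∧ (i + 2 ≤ 2 * T.level ∨ i + 1 ≤ 2 * T.level ∧ ¬ T.Ready)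

namespace OnTrack

theorem round_le (h : T.OnTrack L i) (hL : IsDTARecognizable L) :
    i + 2 ≤ 2 * (minConst L + synIndex L) := by
  obtain ⟨hT, hlevel | ⟨hlevel, hready⟩⟩ := h
  · have := hT.level_le hL
    omega
  · obtain ⟨K', S', E', haction⟩ := exists_action hready
    obtain ⟨T', -, hT', hlt⟩ := hT.exists_copy_of_action hL haction
    have := hT'.level_le hL
    omega

theorem exists_copy_of_action (h : T.OnTrack L i) (hL : IsDTARecognizable L) {K' : ℕ}
    {S' E' : Set (TimedWord α)} (haction : T.Action K' S' E') :
    ∃ T' ∈ T.copies L K' S' E', T'.OnTrack L (i + 1) := by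
  obtain ⟨hT, hlevel⟩ := h
  obtain ⟨T', hmem, hT', hlt⟩ := hT.exists_copy_of_action hL haction
  exact ⟨T', hmem, hT', .inl (by omega)⟩

theorem exists_copy_of_counterexample (h : T.OnTrack L i) (hL : IsDTARecognizable L)
    (hready : T.Ready) {w : TimedWord α} (hw : ¬ (w ∈ T.conj.lang ↔ w ∈ L)) :
    ∃ T' ∈ T.copies L T.K (T.refineRows w) T.E, T'.OnTrack L (i + 1) := by
  obtain ⟨hT, hlevel | ⟨-, hready'⟩⟩ := h
  · obtain ⟨T', hmem, hT', hle, hready'⟩ := hT.exists_copy_of_counterexample hL hready hw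
    exact ⟨T', hmem, hT', .inr ⟨by omega, hready'⟩⟩
  · exact absurd hready hready'

end OnTrack

end ObsTable

namespace LearnState

variable {α : Type u} {L : Set (TimedWord α)} {i : ℕ} {st st' : LearnState α}

/-- The qualitative part of the invariant in round `i`: as long as nothing has been returned, one
of the tables still to be processed is on track. -/
structure Sound [Finite α] (L : Set (TimedWord α)) (i : ℕ) (st : LearnState α) : Prop where
  filled_pool : ∀ T ∈ st.pool, T.Filled L
  filled_next : ∀ T ∈ st.next, T.Filled L
  finite_pool : st.pool.Finite
  finite_next : st.next.Finite
  exists_onTrack : st.result = none →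
    (∃ T ∈ st.pool, T.OnTrack L i) ∨ ∃ T ∈ st.next, T.OnTrack L (i + 1)
  round_le : i + 2 ≤ 2 * (minConst L + synIndex L)
  result_eq_conj : ∀ A, st.result = some A →
    ∃ T : ObsTable α, T.Ready ∧ T.Filled L ∧ A = T.conj ∧ T.conj.lang = L

theorem minConst_add_synIndex_pos [Finite α] (hL : IsDTARecognizable L) :
    0 < minConst L + synIndex L := by
  have := hL.finite_synSetoid
  have : Nonempty (Quotient (synSetoid L)) := ⟨⟦⟨[], isHIWord_nil⟩⟧⟩
  exact Nat.add_pos_right _ Nat.card_pos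

theorem exists_step [Finite α] (hres : st.result = none) : ∃ st', LearnStep L st st' := by
  obtain hpool | ⟨T, hT⟩ := st.pool.eq_empty_or_nonempty
  · exact ⟨_, .advance st hres hpool⟩
  by_cases hready : T.Ready
  · by_cases hlang : T.conj.lang = L
    · exact ⟨_, .confirm st hres T hT hready hlang⟩
    · obtain ⟨w, hw⟩ := not_forall.1 (mt Set.ext hlang)
      exact ⟨_, .refute st hres T hT hready w hw⟩
  · obtain ⟨K', S', E', haction⟩ := ObsTable.exists_action hready
    exact ⟨_, .act st hres T hT hready K' S' E' haction⟩

namespace Sound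

variable [Finite α]

theorem initial (hL : IsDTARecognizable L) : Sound L 0 (LearnState.initial L) where
  filled_pool _ hT := hT.2.2.2
  filled_next _ hT := hT.elim
  finite_pool := ObsTable.finite_filledTables
    (finite_cells 0 (Set.finite_singleton _) (Set.finite_singleton _))
  finite_next := Set.finite_empty
  exists_onTrack _ := by
    obtain ⟨T, hK, hS, hE, hT⟩ := ObsTable.exists_isSyntactic
      hL.isStrictResetFunction_synReset (Nat.zero_le _) IsTableShape.singleton_nil
    have hlevel := T.level_pos
    exact .inl ⟨T, ⟨hK, hS, hE, hT.filled hL.isStrictResetFunction_synReset⟩, hT, .inl (by omega)⟩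
  round_le := by
    have := minConst_add_synIndex_pos hL
    omega
  result_eq_conj _ h := nomatch h

theorem replace (h : st.Sound L i) {T : ObsTable α} (hT : T ∈ st.pool) {K' : ℕ}
    {S' E' : Set (TimedWord α)} (hext : T.IsExtendedBy K' S' E')
    (htrack : T.OnTrack L i → ∃ T' ∈ T.copies L K' S' E', T'.OnTrack L (i + 1))
    (hres : st.result = none) (hpool : st'.pool = st.pool \ {T})
    (hnext : st'.next = st.next ∪ T.copies L K' S' E') (hres' : st'.result = none) :
    st'.Sound L i where
  filled_pool T' hT' := h.filled_pool T' (hpool ▸ hT').1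
  filled_next T' hT' := by
    obtain hT' | hT' := hnext ▸ hT'
    · exact h.filled_next T' hT'
    · exact hT'.2.2.2.1
  finite_pool := hpool ▸ h.finite_pool.sdiff
  finite_next := hnext ▸ h.finite_next.union
    ((ObsTable.finite_filledTables (finite_cells K' hext.finite_S hext.finite_E)).subset
      T.copies_subset_filledTables)
  exists_onTrack _ := by
    rw [hpool, hnext]
    obtain ⟨T', hT', htrack'⟩ | ⟨T', hT', htrack'⟩ := h.exists_onTrack hres
    · obtain rfl | hne := eq_or_ne T' T
      · obtain ⟨T'', hT'', htrack''⟩ := htrack htrack'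
        exact .inr ⟨T'', .inr hT'', htrack''⟩
      · exact .inl ⟨T', ⟨hT', hne⟩, htrack'⟩
    · exact .inr ⟨T', .inl hT', htrack'⟩
  round_le := h.round_le
  result_eq_conj _ hA := nomatch hres'.symm.trans hA

theorem confirm (h : st.Sound L i) {T : ObsTable α} (hT : T ∈ st.pool) (hready : T.Ready)
    (hlang : T.conj.lang = L) (hpool : st'.pool = st.pool \ {T}) (hnext : st'.next = st.next)
    (hres' : st'.result = some T.conj) : st'.Sound L i where
  filled_pool T' hT' := h.filled_pool T' (hpool ▸ hT').1
  filled_next := hnext ▸ h.filled_next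
  finite_pool := hpool ▸ h.finite_pool.sdiff
  finite_next := hnext ▸ h.finite_next
  exists_onTrack hnone := nomatch hres'.symm.trans hnone
  round_le := h.round_le
  result_eq_conj _ hA :=
    ⟨T, hready, h.filled_pool T hT, Option.some_inj.1 (hA.symm.trans hres'), hlang⟩

theorem advance (h : st.Sound L i) (hL : IsDTARecognizable L) (hres : st.result = none)
    (hempty : st.pool = ∅) : Sound L (i + 1) { st with pool := st.next, next := ∅ } := by
  have htrack : ∃ T ∈ st.next, T.OnTrack L (i + 1) :=
    (h.exists_onTrack hres).resolve_left fun ⟨_, hT, _⟩ => (hempty ▸ hT).elim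
  exact
    { filled_pool := h.filled_next
      filled_next := fun _ hT => hT.elim
      finite_pool := h.finite_next
      finite_next := Set.finite_empty
      exists_onTrack := fun _ => .inl htrack
      round_le := htrack.elim fun _ hT => hT.2.round_le hL
      result_eq_conj := h.result_eq_conj }

theorem step (h : st.Sound L i) (hL : IsDTARecognizable L) (hstep : LearnStep L st st') :
    st.pool.Nonempty ∧ st'.Sound L i ∧ st'.pool.ncard < st.pool.ncard ∨
      st.pool = ∅ ∧ st'.Sound L (i + 1) := by
  have hlt : ∀ {T}, T ∈ st.pool → (st.pool \ {T}).ncard < st.pool.ncard :=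
    fun hT => Set.ncard_sdiff_singleton_lt_of_mem hT h.finite_pool
  cases hstep with
  | act hres T hT _ K' S' E' haction =>
      exact .inl ⟨⟨T, hT⟩, h.replace hT haction.isExtendedBy
        (fun htrack => htrack.exists_copy_of_action hL haction) hres rfl rfl rfl, hlt hT⟩
  | refute hres T hT hready w hw =>
      exact .inl ⟨⟨T, hT⟩, h.replace hT (T.isExtendedBy_refineRows w)
        (fun htrack => htrack.exists_copy_of_counterexample hL hready hw) hres rfl rfl rfl,
        hlt hT⟩
  | confirm _ T hT hready hlang =>
      exact .inl ⟨⟨T, hT⟩, h.confirm hT hready hlang rfl rfl rfl, hlt hT⟩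
  | advance hres hempty => exact .inr ⟨hempty, h.advance hL hres hempty⟩

theorem acc {i : ℕ} {st : LearnState α} (h : st.Sound L i) (hL : IsDTARecognizable L) :
    Acc (Function.swap (LearnStep L)) st :=
  ⟨_, fun st' hstep => by
    obtain ⟨-, h', _⟩ | ⟨-, h'⟩ := h.step hL hstep
    · exact h'.acc hL
    · exact h'.acc hL⟩
termination_by (2 * (minConst L + synIndex L) - i, st.pool.ncard)
decreasing_by
  · exact .right _ ‹_›
  · exact .left _ _ (by have := h'.round_le; omega)

theorem exists_isStrictAcceptor [Nonempty α] (h : st.Sound L i)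
    (hstuck : ∀ st', ¬ LearnStep L st st') :
    ∃ (A : OneTA α) (K : ℕ), st.result = some A ∧
      A.IsStrictAcceptor K ∧ A.lang = L ∧ minConst L ≤ K ∧
      ∀ w θs q ν, A.Run A.init 0 w θs q ν → ν ≤ (K : ℝ≥0) ∧ ¬ IsPosInt ν := by
  obtain ⟨A, hA⟩ := Option.ne_none_iff_exists'.1 fun hres =>
    (exists_step (L := L) hres).elim hstuck
  obtain ⟨T, hready, hF, rfl, hlang⟩ := h.result_eq_conj A hA
  have hacceptor := hready.isStrictAcceptor_conj hF
  exact ⟨T.conj, T.K, hA, hacceptor, hlang,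
    Nat.sInf_le ⟨T.conj, hacceptor.det, hacceptor.maxConst_eq, hlang⟩,
    fun _ _ _ _ hrun => hready.run_conj_le hF hrun⟩

end Sound

end LearnState

/-! ### Counting tables and queries -/

namespace LearnState

open scoped ENNReal

/-- The quantitative part of the invariant in round `i`, for counterexamples of length at most `m`.
A table of the pool has at most `sizeBound α H m + 2 - H` cells, so processing it uses up at least
the weight `2⁻¹ ^ (sizeBound α H m + 2 - H)`, while a round starts with a pool of weight at most
one. -/
structure Counted {α : Type u} [Fintype α] (H m i : ℕ) (st : LearnState α) : Prop where
  sized_pool : ∀ T ∈ st.pool, IsSized m i T.K T.S T.E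
  sized_next : ∀ T ∈ st.next, IsSized m (i + 1) T.K T.S T.E
  weight_le : ObsTable.poolWeight st.pool + ObsTable.poolWeight st.next ≤ 1
  processed_le : (st.processed : ℝ≥0∞) * 2⁻¹ ^ (sizeBound α H m + 2 - H) +
    ObsTable.poolWeight st.pool ≤ i + 1
  queries_le : st.queries ≤ ((st.processed + 1) * (24 * sizeBound α H m) : ℕ)

namespace Counted

variable {α : Type u} [Fintype α] {L : Set (TimedWord α)} {H m i : ℕ} {st st' : LearnState α}

theorem advance (h : st.Counted H m i) :
    Counted H m (i + 1) { st with pool := st.next, next := ∅ } where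
  sized_pool := h.sized_next
  sized_next _ hT := hT.elim
  weight_le := by
    rw [ObsTable.poolWeight_empty, add_zero]
    exact le_add_self.trans h.weight_le
  processed_le := by
    push_cast
    exact add_le_add (le_self_add.trans h.processed_le) (le_add_self.trans h.weight_le)
  queries_le := h.queries_le

theorem step_of_empty (h : st.Counted H m i) (hstep : LearnStep L st st') (hpool : st.pool = ∅) :
    st'.Counted H m (i + 1) := by
  cases hstep with
  | act _ T hT | refute _ T hT | confirm _ T hT => exact (hpool ▸ hT).elim
  | advance => exact h.advance

theorem processed_le_mul (h : st.Counted H m i) :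
    st.processed ≤ (i + 1) * 2 ^ (sizeBound α H m + 2 - H) := by
  suffices (st.processed : ℝ≥0∞) ≤ (i + 1) * 2 ^ (sizeBound α H m + 2 - H) by exact_mod_cast this
  rw [← ENNReal.div_le_iff (by simp) (by simp), div_eq_mul_inv, ENNReal.inv_pow]
  exact le_self_add.trans h.processed_le

variable [Nonempty α]

theorem initial (hm : 1 ≤ m) (hH : 1 ≤ H) : Counted H m 0 (LearnState.initial L) := by
  have hfin : (cells (α := α) 0 {[]} {[]}).Finite :=
    finite_cells 0 (Set.finite_singleton _) (Set.finite_singleton _)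
  have hweight : ObsTable.poolWeight (LearnState.initial L).pool ≤ 1 := by
    have := ObsTable.poolWeight_le (L := L) (B := ∅) hfin (Set.empty_subset _) subset_rfl
      fun _ _ _ _ _ _ h => h.elim
    rwa [Set.ncard_empty, pow_zero] at this
  have hcells : (LearnState.initial L).queries ≤ (24 * sizeBound α H m : ℕ) :=
    hfin.cast_ncard_eq.symm.trans_le <| mod_cast
      (IsSized.singleton_nil m 0).ncard_cells_le (Set.finite_singleton _) hm (by omega)
  exact
    { sized_pool := by
        rintro T ⟨hK, hS, hE, -⟩
        rw [hK, hS, hE]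
        exact .singleton_nil m 0
      sized_next := fun _ hT => hT.elim
      weight_le := by simpa [LearnState.initial, ObsTable.poolWeight_empty] using hweight
      processed_le := by simpa [LearnState.initial] using hweight
      queries_le := by simpa [LearnState.initial] using hcells }

theorem two_inv_pow_le_weight (h : st.Counted H m i) (hm : 1 ≤ m) (hi : i + 2 ≤ 2 * H)
    {T : ObsTable α} (hT : T ∈ st.pool) : 2⁻¹ ^ (sizeBound α H m + 2 - H) ≤ T.weight := by
  refine pow_le_pow_right_of_le_one' (ENNReal.inv_le_one.2 one_le_two) ?_
  have := (h.sized_pool T hT).ncard_cells_add_le T.finite_S hm hi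
  omega

theorem replace (h : st.Counted H m i) (hm : 1 ≤ m) (hi : i + 2 ≤ 2 * H) {T : ObsTable α}
    (hT : T ∈ st.pool) {P : Set (ObsTable α)} (hP : ∀ T' ∈ P, IsSized m (i + 1) T'.K T'.S T'.E)
    (hweight : ObsTable.poolWeight P ≤ T.weight) {k : ℕ∞} (hk : k ≤ (24 * sizeBound α H m : ℕ))
    (hpool : st'.pool = st.pool \ {T}) (hnext : st'.next = st.next ∪ P)
    (hprocessed : st'.processed = st.processed + 1) (hqueries : st'.queries = st.queries + k) :
    st'.Counted H m i where
  sized_pool T' hT' := h.sized_pool T' (hpool ▸ hT').1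
  sized_next T' hT' := (hnext ▸ hT').elim (h.sized_next T') (hP T')
  weight_le := by
    rw [hpool, hnext]
    calc ObsTable.poolWeight (st.pool \ {T}) + ObsTable.poolWeight (st.next ∪ P)
        ≤ ObsTable.poolWeight (st.pool \ {T}) + (ObsTable.poolWeight st.next + T.weight) := by
          gcongr
          exact (ObsTable.poolWeight_union_le _ _).trans (by gcongr)
      _ = T.weight + ObsTable.poolWeight (st.pool \ {T}) + ObsTable.poolWeight st.next := by ring
      _ = ObsTable.poolWeight st.pool + ObsTable.poolWeight st.next := by
          rw [ObsTable.weight_add_poolWeight_sdiff_singleton hT]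
      _ ≤ 1 := h.weight_le
  processed_le := by
    have hT_weight := h.two_inv_pow_le_weight hm hi hT
    have hprev := h.processed_le
    rw [hpool, hprocessed, Nat.cast_succ, add_one_mul, add_assoc]
    rw [← ObsTable.weight_add_poolWeight_sdiff_singleton hT] at hprev
    exact le_trans (by gcongr) hprev
  queries_le := by
    rw [hqueries, hprocessed, add_one_mul (st.processed + 1), Nat.cast_add]
    exact add_le_add h.queries_le hk

theorem replace_copies (h : st.Counted H m i) (hm : 1 ≤ m) (hi : i + 2 ≤ 2 * H) {T : ObsTable α}
    (hT : T ∈ st.pool) {K' : ℕ} {S' E' : Set (TimedWord α)} (hext : T.IsExtendedBy K' S' E')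
    (hsized : IsSized m i T.K T.S T.E → IsSized m (i + 1) K' S' E')
    (hpool : st'.pool = st.pool \ {T}) (hnext : st'.next = st.next ∪ T.copies L K' S' E')
    (hprocessed : st'.processed = st.processed + 1)
    (hqueries : st'.queries = st.queries + (T.newCells K' S' E').encard) :
    st'.Counted H m i := by
  have hsized' := hsized (h.sized_pool T hT)
  have hfin : (cells K' S' E').Finite := finite_cells K' hext.finite_S hext.finite_E
  have hnew : (T.newCells K' S' E').encard ≤ (24 * sizeBound α H m : ℕ) := calc
    _ ≤ (cells K' S' E').encard := Set.encard_le_encard Set.sdiff_subset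
    _ = (cells K' S' E').ncard := hfin.cast_ncard_eq.symm
    _ ≤ _ := mod_cast hsized'.ncard_cells_le hext.finite_S hm (by omega)
  refine h.replace hm hi hT ?_ (ObsTable.poolWeight_copies_le hext) hnew hpool hnext hprocessed
    hqueries
  rintro T' ⟨hK, hS, hE, -⟩
  rwa [hK, hS, hE]

theorem step_of_nonempty (h : st.Counted H m i) (hm : 1 ≤ m) (hi : i + 2 ≤ 2 * H)
    (hstep : LearnStep L st st') (hpool : st.pool.Nonempty) (hlongest : st'.longest ≤ m) :
    st'.Counted H m i := by
  cases hstep with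
  | act _ T hT _ K' S' E' haction =>
      exact h.replace_copies hm hi hT haction.isExtendedBy (fun hsized => hsized.action haction hm)
        rfl rfl rfl rfl
  | refute _ T hT _ w _ =>
      exact h.replace_copies hm hi hT (T.isExtendedBy_refineRows w)
        (fun hsized => hsized.refineRows (le_of_max_le_right hlongest)) rfl rfl rfl rfl
  | confirm _ T hT _ _ =>
      exact h.replace hm hi hT (P := ∅) (fun _ h => h.elim)
        (ObsTable.poolWeight_empty.trans_le zero_le) zero_le rfl (Set.union_empty _).symm rfl
        (add_zero _).symm
  | advance _ hempty => exact absurd hempty hpool.ne_empty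

theorem processed_le_four_mul (h : st.Counted H m i) (hm : 1 ≤ m) (hi : i + 2 ≤ 2 * H) :
    st.processed ≤ 4 * 2 ^ sizeBound α H m := by
  have hround : i + 1 ≤ 2 ^ H := by
    have := two_mul_le_two_pow_add_one H
    omega
  have hH : H ≤ sizeBound α H m + 2 := le_add_self.trans <|
    (IsSized.singleton_nil (α := α) m i).ncard_cells_add_le (Set.finite_singleton _) hm hi
  calc st.processed ≤ (i + 1) * 2 ^ (sizeBound α H m + 2 - H) := h.processed_le_mul
    _ ≤ 2 ^ H * 2 ^ (sizeBound α H m + 2 - H) := by gcongr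
    _ = 2 ^ (sizeBound α H m + 2) := by rw [← pow_add, Nat.add_sub_cancel' hH]
    _ = 4 * 2 ^ sizeBound α H m := by ring

theorem queries_le_mul (h : st.Counted H m i) (hm : 1 ≤ m) (hi : i + 2 ≤ 2 * H) :
    st.queries ≤ (120 * (2 ^ sizeBound α H m * sizeBound α H m) : ℕ) := by
  refine h.queries_le.trans (mod_cast ?_)
  have hprocessed := h.processed_le_four_mul hm hi
  have hpow : 1 ≤ 2 ^ sizeBound α H m := Nat.one_le_two_pow
  calc (st.processed + 1) * (24 * sizeBound α H m)
      ≤ 5 * 2 ^ sizeBound α H m * (24 * sizeBound α H m) := by gcongr; omega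
    _ = 120 * (2 ^ sizeBound α H m * sizeBound α H m) := by ring

end Counted

theorem longest_le_of_step {α : Type u} [Finite α] {L : Set (TimedWord α)} {st st' : LearnState α}
    (hstep : LearnStep L st st') : st.longest ≤ st'.longest := by
  cases hstep with
  | refute => exact le_max_left _ _
  | _ => exact le_rfl

theorem exists_sound_counted {α : Type u} [Fintype α] [Nonempty α] {L : Set (TimedWord α)}
    {st : LearnState α} (hL : IsDTARecognizable L)
    (h : Relation.ReflTransGen (LearnStep L) (LearnState.initial L) st) :
    ∃ i, st.Sound L i ∧
      ∀ m, 1 ≤ m → st.longest ≤ m → st.Counted (minConst L + synIndex L) m i := by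
  induction h with
  | refl => exact ⟨0, .initial hL, fun m hm _ => .initial hm (minConst_add_synIndex_pos hL)⟩
  | tail _ hstep ih =>
      obtain ⟨i, hsound, hcounted⟩ := ih
      have hlongest := longest_le_of_step hstep
      obtain ⟨hpool, hsound', -⟩ | ⟨hpool, hsound'⟩ := hsound.step hL hstep
      · exact ⟨i, hsound', fun m hm hm' => (hcounted m hm (hlongest.trans hm')).step_of_nonempty hm
          hsound.round_le hstep hpool hm'⟩
      · exact ⟨i + 1, hsound', fun m hm hm' =>
          (hcounted m hm (hlongest.trans hm')).step_of_empty hstep hpool⟩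

end LearnState

theorem mainTheorem9 :
    ∃ C : ℕ, ∀ (α : Type u) [Fintype α] [Nonempty α] (L : Set (TimedWord α)),
      IsDTARecognizable L →
      -- the algorithm terminates: there is no infinite execution
      (¬ ∃ st : ℕ → LearnState α,
        st 0 = LearnState.initial L ∧ ∀ i, LearnStep L (st i) (st (i + 1))) ∧
      -- every execution that cannot be continued has returned an automaton as claimed
      ∀ st : LearnState α,
        Relation.ReflTransGen (LearnStep L) (LearnState.initial L) st →
        (∀ st', ¬ LearnStep L st st') →
        (∃ (A : OneTA α) (K : ℕ), st.result = some A ∧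
          A.IsStrictAcceptor K ∧ A.lang = L ∧ minConst L ≤ K ∧
          ∀ w θs q ν, A.Run A.init 0 w θs q ν → ν ≤ (K : ℝ≥0) ∧ ¬ IsPosInt ν) ∧
        (∀ H m : ℕ, H = minConst L + synIndex L → m = max 1 st.longest →
          st.processed ≤ C * (2 ^ (H ^ 3 * m * 2 ^ m * Fintype.card α) * H) ∧
          st.queries ≤ ((C * (2 ^ (H ^ 3 * m * 2 ^ m * Fintype.card α) *
            (H ^ 3 * m * 2 ^ m * Fintype.card α)) : ℕ) : ℕ∞)) := by
  refine ⟨120, fun α _ _ L hL => ⟨?_, fun st hreach hstuck => ?_⟩⟩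
  · rintro ⟨st, hinit, hstep⟩
    have hacc := (LearnState.Sound.initial hL).acc hL
    exact (acc_iff_isEmpty_descending_chain.1 hacc).false ⟨st, hinit, hstep⟩
  · obtain ⟨i, hsound, hcounted⟩ := LearnState.exists_sound_counted hL hreach
    refine ⟨hsound.exists_isStrictAcceptor hstuck, ?_⟩
    rintro H m rfl rfl
    have hm := le_max_left 1 st.longest
    have hcounted := hcounted _ hm (le_max_right _ _)
    refine ⟨?_, hcounted.queries_le_mul hm hsound.round_le⟩
    calc st.processed ≤ 4 * 2 ^ sizeBound α (minConst L + synIndex L) (max 1 st.longest) :=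
          hcounted.processed_le_four_mul hm hsound.round_le
      _ ≤ 120 * (2 ^ sizeBound α (minConst L + synIndex L) (max 1 st.longest) *
          (minConst L + synIndex L)) :=
        Nat.mul_le_mul (by norm_num)
          (Nat.le_mul_of_pos_right _ (LearnState.minConst_add_synIndex_pos hL))
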